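/- Let $d\in\{1,2,\dots\}$, let $p\ge 1$ with $p>d/2$, and let $\delta>0$. Let $\mathfrak p_0$ be a Borel probability measure on $\mathbb R^d$ with $m:=\int_{\mathbb R^d}|x|^{2p+\delta}\,\mathfrak p_0(dx)<+\infty$, where $|\cdot|$ is the Euclidean norm. Let $\tilde\xi_1,\tilde\xi_2,\dots$ be the coordinates of $(\mathbb R^d)^\infty$, endowed with the product law $\mathfrak p_0^\infty$ (so that they are i.i.d. with law $\mathfrak p_0$); let $\mathbb E$ denote expectation under $\mathfrak p_0^\infty$, and let $\tilde{\mathfrak e}_n:=\frac1n\sum_{i=1}^n\delta_{\tilde\xi_i}$. For Borel probability measures $\mu,\nu$ on $\mathbb R^d$ put $$W_p(\mu,\nu):=\inf_{\gamma}\Big(\int_{\mathbb R^d\times\mathbb R^d}|x-y|^p\,\gamma(dx\,dy)\Big)^{1/p},$$ the infimum being over all probability measures $\gamma$ on $\mathbb R^d\times\mathbb R^d$ with marginals $\mu$ and $\nu$. Put $\mathrm{Log}_2(x):=1$ for $x<e^e$, $\mathrm{Log}_2(x):=\log\log x$ for $x\ge e^e$, and $b_n:=(n/\mathrm{Log}_2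 n)^{1/(2p)}$. Let $$M:=\max\Big\{2-\frac pd,\ 1+\frac{1}{2+\delta/p}\Big\},\qquad K(p,d):=2^{2p}d^{p/2}\,\frac{2^p+1}{(2^p-1)^2},$$ $$\lambda:=p-d\Big(2-\frac3r\Big),\qquad \sigma:=(2p+\delta)\Big(\frac3r-1\Big)-p .$$ Then $W_p(\mathfrak p_0,\tilde{\mathfrak e}_n)$ is a random variable for every $n\ge1$, the interval $(2,3/M)$ is non-empty, and there is a constant $\overline C(r)>0$, depending only on $r$ (not on $d,p,\delta,\mathfrak p_0$), such that, for every $r\in(2,3/M)$, one has $\lambda>0$, $\sigma>0$ and $$\mathbb E\Big[\Big(\sup_{n\ge1}b_n\,W_p(\mathfrak p_0,\tilde{\mathfrak e}_n)\Big)^p\Big]\le C_p(\mathfrak p_0):=\frac{K(p,d)\,\overline C(r)}{1-2^{-\lambda}}\Big[1+\frac{2^p}{1-2^{-\sigma}}\,m^{\frac3r-1}\Big].$$ Moreover, $\mathfrak p_0^\infty$-almost surely, $$\limsup_{n\to+\infty}b_n\,W_p(\mathfrak p_0,\tilde{\mathfrak e}_n)\le Y_p(\mathfrak p_0):=\Big\{\frac{\sqrt2\,K(p,d)}{1-2^{-(p-d/2)}}\Big[1+\frac{2^p}{1-2^{-\delta/2}}\,m^{1/2}\Big]\Big\}^{1/p}.$$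 -/

import Mathlib

open MeasureTheory Filter
open scoped ENNReal

noncomputable section

namespace EmpiricalWasserstein

/-- The law of an i.i.d. sequence with common distribution `μ`: the product measure `μ^∞` on the
sequence space `X^ℕ`. The coordinates `ω 0, ω 1, …` are the observations. -/
def iidLaw {X : Type*} [MeasurableSpace X] (μ : Measure X) : Measure (ℕ → X) :=
  Measure.infinitePi (fun _ : ℕ => μ)

/-- The empirical measure `(1/n) ∑ δ` of the first `n` observations. -/
def empiricalMeasure {X : Type*} [MeasurableSpace X] (n : ℕ) (ω : ℕ → X) : Measure X :=
  (n : ℝ≥0∞)⁻¹ • ∑ i ∈ Finset.range n, Measure.dirac (ω i)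

/-- The `p`-Wasserstein distance: the infimum, over all measures `γ` on the product space with
marginals `μ` and `ν`, of `(∫ d(x,y)^p γ(dx dy))^(1/p)`. -/
def wassersteinDist {X : Type*} [PseudoEMetricSpace X] [MeasurableSpace X]
    (p : ℝ) (μ ν : Measure X) : ℝ≥0∞ :=
  ⨅ γ : {γ : Measure (X × X) // γ.map Prod.fst = μ ∧ γ.map Prod.snd = ν},
    (∫⁻ z, edist z.1 z.2 ^ p ∂γ.1) ^ (1 / p)

/-- `Log₂ x = 1` for `x < e^e`, and `log log x` for `x ≥ e^e`. -/
def logTwo (x : ℝ) : ℝ :=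
  if x < Real.exp (Real.exp 1) then 1 else Real.log (Real.log x)

/-- The rate `b_n = (n / Log₂ n)^(1/(2p))`. -/
def rate (p : ℝ) (n : ℕ) : ℝ := ((n : ℝ) / logTwo n) ^ (1 / (2 * p))

/-- The random variable `b_n W_p(μ, e_n)`. -/
def scaledDist {X : Type*} [PseudoEMetricSpace X] [MeasurableSpace X]
    (p : ℝ) (μ : Measure X) (n : ℕ) (ω : ℕ → X) : ℝ≥0∞ :=
  ENNReal.ofReal (rate p n) * wassersteinDist p μ (empiricalMeasure n ω)

/-- `M = max {2 - p/d, 1 + 1/(2 + δ/p)}`. -/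
def constM (d : ℕ) (p δ : ℝ) : ℝ := max (2 - p / d) (1 + 1 / (2 + δ / p))

/-- `K(p,d) = 2^(2p) d^(p/2) (2^p + 1) (2^p - 1)^(-2)`. -/
def constK (d : ℕ) (p : ℝ) : ℝ :=
  (2 : ℝ) ^ (2 * p) * (d : ℝ) ^ (p / 2) * ((2 : ℝ) ^ p + 1) / ((2 : ℝ) ^ p - 1) ^ 2

/-- `λ = p - d (2 - 3/r)`. -/
def expLambda (d : ℕ) (p r : ℝ) : ℝ := p - d * (2 - 3 / r)

/-- `σ = (2p + δ) (3/r - 1) - p`. -/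
def expSigma (p δ r : ℝ) : ℝ := (2 * p + δ) * (3 / r - 1) - p

/-- The absolute moment `∫ |x|^β μ(dx)`. -/
def absMoment {d : ℕ} (β : ℝ) (μ : Measure (EuclideanSpace ℝ (Fin d))) : ℝ :=
  ∫ x, ‖x‖ ^ β ∂μ

/-- The constant `C_p(μ)`; the argument `c` stands for the value at `r` of the constant
depending on `r` only. -/
def constC {d : ℕ} (p δ r c : ℝ) (μ : Measure (EuclideanSpace ℝ (Fin d))) : ℝ :=
  constK d p * c / (1 - (2 : ℝ) ^ (-expLambda d p r)) *
    (1 + (2 : ℝ) ^ p / (1 - (2 : ℝ) ^ (-expSigma p δ r)) *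
      absMoment (2 * p + δ) μ ^ (3 / r - 1))

/-- The constant `Y_p(μ)`. -/
def constY {d : ℕ} (p δ : ℝ) (μ : Measure (EuclideanSpace ℝ (Fin d))) : ℝ :=
  (Real.sqrt 2 * constK d p / (1 - (2 : ℝ) ^ (-(p - (d : ℝ) / 2))) *
    (1 + (2 : ℝ) ^ p / (1 - (2 : ℝ) ^ (-(δ / 2))) *
      absMoment (2 * p + δ) μ ^ ((1 : ℝ) / 2))) ^ (1 / p)

end EmpiricalWasserstein

end

/-! Cut space into dyadic shells `2^(k-1) < |x| ≤ 2^k` (shell `0` being the unit ball) and, at level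
`l`, cut each shell into cells of diameter at most `2^(k-l)`. Matching the two measures inside fine
cells and passing the excesses on to coarser ones bounds `W_p^p` by a weighted sum of the
discrepancies `|μ(A) - e_n(A)|` of the cells (`wassersteinDist_rpow_le`). Since `b_n^p = √(n / Log₂
n)`, every discrepancy arrives with the normalization of the law of the iterated logarithm.

Moment bound: for `0 < s < 1/2` the supremum over `n` of the normalized discrepancy of `A` has mean
at most `C(s) μ(A)^s` (`lintegral_supDeviation_le`). On dyadic blocks of indices this comes from an
exponential maximal inequality, or from a first moment when `A` is expected to be hit at most about
once. Take `s = 3/r - 1`. A shell has at most `(32 * 2^l)^d` cells of level `l`, so concavity of the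
power `s` makes the sum over levels geometric of ratio `2^(-λ)`; Markov's inequality makes the sum
over shells geometric of ratio `2^(-σ)`. The conditions on `r` say precisely that `s < 1/2`, `λ > 0`
and `σ > 0`. The factor exponential in `d` is absorbed by `d^(p/2)` and an absolute constant
(`covering_constant_le`).

Almost sure bound: the moment bounds make the fine levels, and all but finitely many cells of one
level, negligible uniformly in `n`. What remains is a finite weighted sum of absolute discrepancies,
that is, a maximum over finitely many sign patterns of signed sums. The cells being disjoint, each
signed sum has variance at most `∫ 2^(2pk)`, `k` being the index of the shell, and the law of the
iterated logarithm applies to it (`ae_eventually_sum_deviation_le`). -/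

namespace EmpiricalWasserstein

/-! ### Couplings built along nested partitions -/

section Coupling

variable {X ι : Type*} [MeasurableSpace X] [MeasurableSpace ι] [MeasurableSingletonClass ι]

/-- Cutting a measure by factors constant on the fibres of a countable-valued map. -/
lemma sum_smul_restrict_fiber {Q : X → ι} (hQ : Measurable Q) (α : Measure X) (c : ι → ℝ≥0∞)
    (i : ι) :
    Measure.sum (fun j => c j • α.restrict (Q ⁻¹' {j})) (Q ⁻¹' {i}) = c i * α (Q ⁻¹' {i}) := by
  have hm : ∀ j, MeasurableSet (Q ⁻¹' {j}) := fun j => hQ (measurableSet_singleton j)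
  rw [Measure.sum_apply _ (hm i), tsum_eq_single i]
  · simp [Measure.restrict_apply (hm i)]
  · intro j hj
    have : Q ⁻¹' {i} ∩ Q ⁻¹' {j} = ∅ := by
      ext x; simp only [Set.mem_inter_iff, Set.mem_preimage, Set.mem_singleton_iff,
        Set.mem_empty_iff_false, iff_false, not_and]
      rintro rfl h; exact hj h.symm
    simp [Measure.restrict_apply (hm i), this]

variable [Countable ι]

lemma sum_restrict_fiber {Q : X → ι} (hQ : Measurable Q) (α : Measure X) :
    Measure.sum (fun j => α.restrict (Q ⁻¹' {j})) = α := by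
  rw [← Measure.restrict_iUnion]
  · have : (⋃ j, Q ⁻¹' {j}) = Set.univ := by ext; simp
    rw [this, Measure.restrict_univ]
  · intro i j hij
    rw [Function.onFun, Set.disjoint_left]
    rintro x rfl h
    exact hij h
  · exact fun j => hQ (measurableSet_singleton j)

lemma inv_max_mul_le (a b : ℝ≥0∞) : (max a b)⁻¹ * b ≤ 1 := by
  rw [mul_comm, ← div_eq_mul_inv]
  exact ENNReal.div_le_of_le_mul (by rw [one_mul]; exact le_max_right a b)

lemma one_sub_inv_max_mul (a b : ℝ≥0∞) (ha : a ≠ ∞) (hb : b ≠ ∞) :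
    (1 - (max a b)⁻¹ * b) * a = a - b := by
  rcases le_total a b with h | h
  · rw [max_eq_right h, tsub_eq_zero_of_le h]
    rcases eq_or_ne b 0 with rfl | hb0
    · simp [le_antisymm h bot_le]
    · rw [ENNReal.inv_mul_cancel hb0 hb]; simp
  · rw [max_eq_left h]
    rcases eq_or_ne a 0 with rfl | ha0
    · simp
    · rw [ENNReal.sub_mul (by simp [ha]), one_mul, mul_assoc, mul_comm b a, ← mul_assoc,
        ENNReal.inv_mul_cancel ha0 ha, one_mul]

/-- Two measures can be matched inside the fibres of `Q` up to their excesses on the fibres. -/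
lemma exists_matching {Q : X → ι} (hQ : Measurable Q) (α β : Measure X) [IsFiniteMeasure α]
    [IsFiniteMeasure β] :
    ∃ (π : Measure (X × X)) (α' β' : Measure X),
      π.map Prod.fst + α' = α ∧ π.map Prod.snd + β' = β ∧ (∀ᵐ z ∂π, Q z.1 = Q z.2) ∧
      (∀ i, α' (Q ⁻¹' {i}) = α (Q ⁻¹' {i}) - β (Q ⁻¹' {i})) ∧
      (∀ i, β' (Q ⁻¹' {i}) = β (Q ⁻¹' {i}) - α (Q ⁻¹' {i})) := by
  have hm : ∀ j, MeasurableSet (Q ⁻¹' {j}) := fun j => hQ (measurableSet_singleton j)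
  set F : ι → Set X := fun j => Q ⁻¹' {j}
  set M : ι → ℝ≥0∞ := fun j => max (α (F j)) (β (F j))
  -- Dividing by the larger of the two masses moves exactly the smaller one, so both leftovers are
  -- truncated excesses. On a fibre null for both measures the product vanishes, whatever the
  -- inverse is.
  refine ⟨Measure.sum fun j => (M j)⁻¹ • (α.restrict (F j)).prod (β.restrict (F j)),
    Measure.sum fun j => (1 - (M j)⁻¹ * β (F j)) • α.restrict (F j),
    Measure.sum fun j => (1 - (M j)⁻¹ * α (F j)) • β.restrict (F j), ?_, ?_, ?_, ?_, ?_⟩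
  · rw [Measure.map_sum measurable_fst.aemeasurable, Measure.sum_add_sum]
    conv_rhs => rw [← sum_restrict_fiber hQ α]
    congr 1
    ext1 j
    rw [Measure.map_smul, Measure.map_fst_prod, Measure.restrict_apply_univ, smul_smul, ← add_smul,
      add_tsub_cancel_of_le (inv_max_mul_le _ _), one_smul]
  · rw [Measure.map_sum measurable_snd.aemeasurable, Measure.sum_add_sum]
    conv_rhs => rw [← sum_restrict_fiber hQ β]
    congr 1
    ext1 j
    rw [Measure.map_smul, Measure.map_snd_prod, Measure.restrict_apply_univ, smul_smul, ← add_smul,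
      add_tsub_cancel_of_le (by
        simp only [M]; rw [max_comm]; exact inv_max_mul_le _ _), one_smul]
  · rw [ae_iff, Measure.sum_apply_eq_zero]
    intro j
    rw [Measure.smul_apply, Measure.prod_restrict]
    have : ((α.prod β).restrict (F j ×ˢ F j)) {z | ¬ Q z.1 = Q z.2} = 0 := by
      rw [← ae_iff]
      refine (ae_restrict_iff' ((hm j).prod (hm j))).2 (ae_of_all _ ?_)
      rintro z ⟨h1, h2⟩
      exact (show Q z.1 = j from h1).trans (show Q z.2 = j from h2).symm
    rw [this, smul_zero]
  · intro i
    rw [sum_smul_restrict_fiber hQ]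
    exact one_sub_inv_max_mul _ _ (measure_ne_top _ _) (measure_ne_top _ _)
  · intro i
    rw [sum_smul_restrict_fiber hQ]
    simp only [M]
    rw [max_comm]
    exact one_sub_inv_max_mul _ _ (measure_ne_top _ _) (measure_ne_top _ _)

lemma lintegral_comp_eq_tsum {Q : X → ι} (hQ : Measurable Q) (α : Measure X) (w : ι → ℝ≥0∞) :
    ∫⁻ x, w (Q x) ∂α = ∑' i, w i * α (Q ⁻¹' {i}) := by
  have hw : Measurable w := measurable_of_countable w
  rw [← lintegral_map hw hQ, lintegral_countable']
  congr 1; ext i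
  rw [Measure.map_apply hQ (measurableSet_singleton i)]

/-- Bottom-up matching along the levels `l, …, l + j` of a refining sequence of partitions. -/
lemma exists_partial_coupling {Q : ℕ → X → ι} (hQ : ∀ l, Measurable (Q l))
    (href : ∀ l x y, Q (l + 1) x = Q (l + 1) y → Q l x = Q l y)
    {c : X × X → ℝ≥0∞} {w : ℕ → ι → ℝ≥0∞}
    (hc : ∀ l x y, Q l x = Q l y → c (x, y) ≤ w l (Q l x))
    (hw : ∀ l x, w l (Q (l + 1) x) = w l (Q l x))
    (μ ν : Measure X) [IsFiniteMeasure μ] [IsFiniteMeasure ν] (j : ℕ) :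
    ∀ l, ∃ (π : Measure (X × X)) (α β : Measure X),
      π.map Prod.fst + α = μ ∧ π.map Prod.snd + β = ν ∧ (∀ᵐ z ∂π, Q l z.1 = Q l z.2) ∧
      (∀ i, α (Q l ⁻¹' {i}) = μ (Q l ⁻¹' {i}) - ν (Q l ⁻¹' {i})) ∧
      (∀ i, β (Q l ⁻¹' {i}) = ν (Q l ⁻¹' {i}) - μ (Q l ⁻¹' {i})) ∧
      ∫⁻ z, c z ∂π ≤ ∫⁻ x, w (l + j) (Q (l + j) x) ∂μ +
        ∑ t ∈ Finset.range j, ∑' i, w (l + t) i *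
          (μ (Q (l + t + 1) ⁻¹' {i}) - ν (Q (l + t + 1) ⁻¹' {i})) := by
  have hww : ∀ l, Measurable (w l) := fun l => measurable_of_countable (w l)
  have key : ∀ l (π : Measure (X × X)), (∀ᵐ z ∂π, Q l z.1 = Q l z.2) →
      ∫⁻ z, c z ∂π ≤ ∫⁻ x, w l (Q l x) ∂(π.map Prod.fst) := by
    intro l π h
    rw [lintegral_map (show Measurable fun x => w l (Q l x) from (hww l).comp (hQ l))
      measurable_fst]
    exact lintegral_mono_ae (h.mono fun z hz => hc l z.1 z.2 hz)
  induction j with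
  | zero =>
    intro l
    obtain ⟨π, α, β, h1, h2, h3, h4, h5⟩ := exists_matching (hQ l) μ ν
    refine ⟨π, α, β, h1, h2, h3, h4, h5, ?_⟩
    simp only [add_zero, Finset.range_zero, Finset.sum_empty]
    refine (key l π h3).trans (lintegral_mono' ?_ le_rfl)
    rw [← h1]; exact Measure.le_add_right le_rfl
  | succ j ih =>
    intro l
    -- The coarsest level is treated last: the levels from `l + 1` on are already matched, and only
    -- the leftovers are paired inside the cells of level `l`.
    obtain ⟨π, α, β, h1, h2, h3, h4, h5, h6⟩ := ih (l + 1)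
    have hα : IsFiniteMeasure α := isFiniteMeasure_of_le μ (by
      rw [← h1]; exact Measure.le_add_left le_rfl)
    have hβ : IsFiniteMeasure β := isFiniteMeasure_of_le ν (by
      rw [← h2]; exact Measure.le_add_left le_rfl)
    obtain ⟨π', α', β', g1, g2, g3, g4, g5⟩ := exists_matching (hQ l) α β
    have h3' : ∀ᵐ z ∂π, Q l z.1 = Q l z.2 := h3.mono fun z hz => href l _ _ hz
    have hm : ∀ j, MeasurableSet (Q l ⁻¹' {j}) := fun j => hQ l (measurableSet_singleton j)
    -- By refinement the matched part has equal marginal masses on each cell of level `l`. It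
    -- therefore cancels in the differences, and the excesses of the leftovers are those of `μ` and
    -- `ν`.
    have hfs : ∀ i, π.map Prod.fst (Q l ⁻¹' {i}) = π.map Prod.snd (Q l ⁻¹' {i}) := by
      intro i
      rw [Measure.map_apply measurable_fst (hm i), Measure.map_apply measurable_snd (hm i)]
      refine measure_congr (h3'.mono fun z hz => ?_)
      simp only [eq_iff_iff]
      change Q l z.1 = i ↔ Q l z.2 = i
      rw [hz]
    have hfin : ∀ i, π.map Prod.snd (Q l ⁻¹' {i}) ≠ ∞ := by
      intro i
      refine ne_top_of_le_ne_top (measure_ne_top ν (Q l ⁻¹' {i})) ?_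
      rw [← h2]; exact le_self_add
    have hμ : ∀ i, μ (Q l ⁻¹' {i}) = π.map Prod.snd (Q l ⁻¹' {i}) + α (Q l ⁻¹' {i}) := by
      intro i; rw [← hfs, ← h1]; rfl
    have hν : ∀ i, ν (Q l ⁻¹' {i}) = π.map Prod.snd (Q l ⁻¹' {i}) + β (Q l ⁻¹' {i}) := by
      intro i; conv_lhs => rw [← h2]
      rfl
    refine ⟨π + π', α', β', ?_, ?_, ?_, ?_, ?_, ?_⟩
    · rw [Measure.map_add _ _ measurable_fst, add_assoc, g1, h1]
    · rw [Measure.map_add _ _ measurable_snd, add_assoc, g2, h2]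
    · rw [ae_add_measure_iff]; exact ⟨h3', g3⟩
    · intro i; rw [g4, hμ, hν, ENNReal.add_sub_add_eq_sub_left (hfin i)]
    · intro i; rw [g5, hμ, hν, ENNReal.add_sub_add_eq_sub_left (hfin i)]
    · rw [lintegral_add_measure, Finset.sum_range_succ', ← add_assoc]
      refine add_le_add ?_ ?_
      · refine h6.trans (le_of_eq ?_)
        rw [show l + 1 + j = l + (j + 1) by ring]
        congr 1
        refine Finset.sum_congr rfl fun t _ => ?_
        rw [show l + 1 + t = l + (t + 1) by ring]
      · calc ∫⁻ z, c z ∂π' ≤ ∫⁻ x, w l (Q l x) ∂(π'.map Prod.fst) := key l π' g3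
          _ ≤ ∫⁻ x, w l (Q l x) ∂α := by
            refine lintegral_mono' ?_ le_rfl
            conv_rhs => rw [← g1]
            exact Measure.le_add_right le_rfl
          -- The weight of level `l` is constant on the cells of level `l + 1`, where the masses of
          -- `α` are known.
          _ = ∫⁻ x, w l (Q (l + 1) x) ∂α := by simp_rw [hw]
          _ = _ := by
            rw [lintegral_comp_eq_tsum (hQ (l + 1))]
            simp_rw [h4]; simp

/-- The absolute difference of the masses that two measures give to a set. -/
def massDiff (μ ν : Measure X) (A : Set X) : ℝ≥0∞ := (μ A - ν A) + (ν A - μ A)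

/-- The coupling obtained by matching along the levels `l, …, l + j` and pairing the rest. -/
lemma exists_coupling_of_levels {Q : ℕ → X → ι} (hQ : ∀ l, Measurable (Q l))
    (href : ∀ l x y, Q (l + 1) x = Q (l + 1) y → Q l x = Q l y)
    {c : X × X → ℝ≥0∞} {w : ℕ → ι → ℝ≥0∞} {r : ι → ℝ≥0∞}
    (hc : ∀ l x y, Q l x = Q l y → c (x, y) ≤ w l (Q l x))
    (hw : ∀ l x, w l (Q (l + 1) x) = w l (Q l x))
    (l j : ℕ) (hr : ∀ x y, c (x, y) ≤ r (Q l x) + r (Q l y))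
    (μ ν : Measure X) [IsProbabilityMeasure μ] [IsProbabilityMeasure ν] :
    ∃ γ : Measure (X × X), (γ.map Prod.fst = μ ∧ γ.map Prod.snd = ν) ∧
      ∫⁻ z, c z ∂γ ≤ ∑' i, r i * massDiff μ ν (Q l ⁻¹' {i}) +
        ∑ t ∈ Finset.range j, ∑' i, w (l + t) i * massDiff μ ν (Q (l + t + 1) ⁻¹' {i}) +
        ∫⁻ x, w (l + j) (Q (l + j) x) ∂μ := by
  obtain ⟨π, α, β, h1, h2, -, h4, h5, h6⟩ := exists_partial_coupling hQ href hc hw μ ν j l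
  have hα : IsFiniteMeasure α := isFiniteMeasure_of_le μ (by
    rw [← h1]; exact Measure.le_add_left le_rfl)
  have hβ : IsFiniteMeasure β := isFiniteMeasure_of_le ν (by
    rw [← h2]; exact Measure.le_add_left le_rfl)
  have huniv : α Set.univ = β Set.univ := by
    have e1 : π Set.univ + α Set.univ = 1 := by
      rw [← measure_univ (μ := μ)]; conv_rhs => rw [← h1]
      rw [Measure.add_apply, Measure.map_apply measurable_fst .univ, Set.preimage_univ]
    have e2 : π Set.univ + β Set.univ = 1 := by
      rw [← measure_univ (μ := ν)]; conv_rhs => rw [← h2]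
      rw [Measure.add_apply, Measure.map_apply measurable_snd .univ, Set.preimage_univ]
    have hp : π Set.univ ≠ ∞ := fun h => by simp [h] at e1
    exact (ENNReal.add_right_inj hp).1 (e1.trans e2.symm)
  have hrm : Measurable r := measurable_of_countable r
  -- The leftovers have equal total mass, so their rescaled product couples them; if that mass is
  -- zero, both vanish.
  set π' := (α Set.univ)⁻¹ • α.prod β with hπ'
  have hf : π'.map Prod.fst = α := by
    rw [hπ', Measure.map_smul, Measure.map_fst_prod, ← huniv, smul_smul]
    rcases eq_or_ne (α Set.univ) 0 with h | h
    · rw [Measure.measure_univ_eq_zero.1 h, smul_zero]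
    · rw [ENNReal.inv_mul_cancel h (measure_ne_top _ _), one_smul]
  have hs : π'.map Prod.snd = β := by
    rw [hπ', Measure.map_smul, Measure.map_snd_prod, smul_smul]
    rcases eq_or_ne (α Set.univ) 0 with h | h
    · rw [huniv] at h
      rw [Measure.measure_univ_eq_zero.1 h, smul_zero]
    · rw [ENNReal.inv_mul_cancel h (measure_ne_top _ _), one_smul]
  have hcost : ∫⁻ z, c z ∂π' ≤ ∑' i, r i * massDiff μ ν (Q l ⁻¹' {i}) := by
    calc ∫⁻ z, c z ∂π' ≤ ∫⁻ z, (r (Q l z.1) + r (Q l z.2)) ∂π' :=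
          lintegral_mono fun z => hr z.1 z.2
      _ = ∫⁻ x, r (Q l x) ∂α + ∫⁻ x, r (Q l x) ∂β := by
          have hrQ : Measurable fun x => r (Q l x) := hrm.comp (hQ l)
          have hrQ' : Measurable fun z : X × X => r (Q l z.1) := hrQ.comp measurable_fst
          rw [lintegral_add_left hrQ', ← hf, ← hs, lintegral_map hrQ measurable_fst,
            lintegral_map hrQ measurable_snd]
      _ = _ := by
          rw [lintegral_comp_eq_tsum (hQ l), lintegral_comp_eq_tsum (hQ l), ← ENNReal.tsum_add]
          simp_rw [h4, h5, massDiff, mul_add]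
  refine ⟨π + π', ⟨?_, ?_⟩, ?_⟩
  · rw [Measure.map_add _ _ measurable_fst, hf, h1]
  · rw [Measure.map_add _ _ measurable_snd, hs, h2]
  · rw [lintegral_add_measure, add_comm, add_assoc]
    refine add_le_add hcost (h6.trans ?_)
    rw [add_comm]
    refine add_le_add_left (Finset.sum_le_sum fun t _ => ENNReal.tsum_le_tsum fun i => ?_) _
    gcongr
    exact le_self_add

end Coupling

/-! ### Measurability of the distance to the empirical measure -/

section Measurability

open Topology

lemma lintegral_empiricalMeasure {X : Type*} [MeasurableSpace X] [MeasurableSingletonClass X]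
    (n : ℕ) (ω : ℕ → X) (f : X → ℝ≥0∞) :
    ∫⁻ x, f x ∂(empiricalMeasure n ω) = (n : ℝ≥0∞)⁻¹ * ∑ i ∈ Finset.range n, f (ω i) := by
  rw [empiricalMeasure, lintegral_smul_measure, lintegral_finsetSum_measure]
  simp [lintegral_dirac]

lemma empiricalMeasure_apply {X : Type*} [MeasurableSpace X] (n : ℕ) (ω : ℕ → X) {A : Set X}
    (hA : MeasurableSet A) :
    empiricalMeasure n ω A
      = (n : ℝ≥0∞)⁻¹ * ∑ i ∈ Finset.range n, A.indicator (fun _ => (1 : ℝ≥0∞)) (ω i) := by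
  simp [empiricalMeasure, Measure.finsetSum_apply, Measure.dirac_apply' _ hA]
  rfl

lemma isProbabilityMeasure_empiricalMeasure {X : Type*} [MeasurableSpace X] {n : ℕ} (hn : 1 ≤ n)
    (ω : ℕ → X) : IsProbabilityMeasure (empiricalMeasure n ω) := by
  refine ⟨?_⟩
  rw [empiricalMeasure_apply n ω .univ]
  simp only [Set.indicator_univ, Finset.sum_const, Finset.card_range, nsmul_eq_mul, mul_one]
  exact ENNReal.inv_mul_cancel (by simp; omega) (by simp)

variable {p : ℝ}

lemma edist_rpow_le {E : Type*} [SeminormedAddCommGroup E] (hp : 1 ≤ p) (x y : E) :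
    edist x y ^ p ≤ 2 ^ (p - 1) * (‖x‖ₑ ^ p + ‖y‖ₑ ^ p) := by
  rw [edist_eq_enorm_sub]
  exact (ENNReal.rpow_le_rpow (enorm_sub_le) (by linarith)).trans
    (ENNReal.rpow_add_le_mul_rpow_add_rpow _ _ hp)

variable {E : Type*} [NormedAddCommGroup E] [SecondCountableTopology E] [MeasurableSpace E]
  [BorelSpace E]

/-- Dominated convergence: near `y` the integrand is at most a multiple of `‖x‖ ^ p + (‖y‖ + 1) ^
p`. -/
lemma continuous_lintegral_edist_rpow (hp : 1 ≤ p) {κ : Measure E} [IsFiniteMeasure κ]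
    (hκ : ∫⁻ x, ‖x‖ₑ ^ p ∂κ ≠ ∞) : Continuous fun y => ∫⁻ x, edist x y ^ p ∂κ := by
  have hp0 : 0 ≤ p := by linarith
  rw [continuous_iff_continuousAt]
  intro y
  refine tendsto_lintegral_filter_of_dominated_convergence
    (fun x => 2 ^ (p - 1) * (‖x‖ₑ ^ p + (‖y‖ₑ + 1) ^ p)) ?_ ?_ ?_ ?_
  · refine Eventually.of_forall fun z => ?_
    exact (measurable_id.edist measurable_const).pow_const p
  · have : ∀ᶠ z in 𝓝 y, ‖z‖ₑ < ‖y‖ₑ + 1 := by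
      refine (continuous_enorm.tendsto y).eventually (Iio_mem_nhds ?_)
      exact ENNReal.lt_add_right (by simp) (by simp)
    filter_upwards [this] with z hz
    refine ae_of_all _ fun x => (edist_rpow_le hp x z).trans ?_
    gcongr
  · rw [lintegral_const_mul _ (by fun_prop), lintegral_add_right _ measurable_const,
      lintegral_const]
    refine ENNReal.mul_ne_top (by simp) (ENNReal.add_ne_top.2 ⟨hκ, ENNReal.mul_ne_top ?_ ?_⟩)
    · exact ENNReal.rpow_ne_top_of_nonneg hp0 (by simp)
    · exact measure_ne_top _ _
  · refine ae_of_all _ fun x => ?_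
    exact ((ENNReal.continuous_rpow_const).comp
      (continuous_const.edist continuous_id)).tendsto y

variable [CompleteSpace E]

/-- A coupling with an empirical measure amounts to splitting `μ` into `n` parts of mass `1 / n`. -/
lemma wassersteinDist_empiricalMeasure_lt_iff (μ : Measure E) [IsProbabilityMeasure μ] {n : ℕ}
    (hn : 1 ≤ n) (ω : ℕ → E) (c : ℝ≥0∞) :
    wassersteinDist p μ (empiricalMeasure n ω) < c ↔
      ∃ κ : ℕ → Measure E, (∀ i, IsProbabilityMeasure (κ i)) ∧
        (n : ℝ≥0∞)⁻¹ • ∑ i ∈ Finset.range n, κ i = μ ∧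
        ((n : ℝ≥0∞)⁻¹ * ∑ i ∈ Finset.range n, ∫⁻ x, edist x (ω i) ^ p ∂(κ i)) ^ (1 / p) < c := by
  have hcm : Measurable fun z : E × E => edist z.1 z.2 ^ p :=
    (measurable_fst.edist measurable_snd).pow_const p
  rw [wassersteinDist, iInf_lt_iff]
  constructor
  · rintro ⟨⟨γ, hγ1, hγ2⟩, hlt⟩
    have : IsProbabilityMeasure γ := ⟨by
      rw [← Set.preimage_univ (f := Prod.fst), ← Measure.map_apply measurable_fst .univ, hγ1,
        measure_univ]⟩
    -- The parts of `μ` are the conditional laws given the observation. Repeated observations share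
    -- a kernel and need no separate treatment.
    set ρ := γ.map Prod.swap with hρ
    have : IsProbabilityMeasure ρ := Measure.isProbabilityMeasure_map (by fun_prop)
    have hfst : ρ.fst = empiricalMeasure n ω := by
      rw [Measure.fst, hρ, Measure.map_map measurable_fst measurable_swap, ← hγ2]; rfl
    have key : ∀ f : E × E → ℝ≥0∞, Measurable f →
        (n : ℝ≥0∞)⁻¹ * ∑ i ∈ Finset.range n, ∫⁻ x, f (x, ω i) ∂(ρ.condKernel (ω i))
          = ∫⁻ z, f z ∂γ := by
      intro f hf
      have h1 := Measure.lintegral_condKernel (ρ := ρ) (hf.comp measurable_swap)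
      rw [hfst, lintegral_empiricalMeasure] at h1
      refine h1.trans ?_
      rw [hρ, lintegral_map (hf.comp measurable_swap) measurable_swap]
      simp
    refine ⟨fun i => ρ.condKernel (ω i), fun i => inferInstance, ?_, ?_⟩
    · ext A hA
      rw [← hγ1, Measure.map_apply measurable_fst hA,
        ← lintegral_indicator_one (measurable_fst hA), ← key _ (measurable_one.indicator
          (measurable_fst hA))]
      simp only [Measure.smul_apply, Measure.finsetSum_apply, smul_eq_mul]
      congr 1
      refine Finset.sum_congr rfl fun i _ => ?_
      rw [← lintegral_indicator_one hA]
      rfl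
    · rw [key _ hcm]
      exact hlt
  · rintro ⟨κ, hκ, hμ, hlt⟩
    have hcoef : (n : ℝ≥0∞)⁻¹ * n = 1 := ENNReal.inv_mul_cancel (by simp; omega) (by simp)
    refine ⟨⟨(n : ℝ≥0∞)⁻¹ • ∑ i ∈ Finset.range n, (κ i).prod (Measure.dirac (ω i)), ?_, ?_⟩, ?_⟩
    · rw [Measure.map_smul, Measure.map_finset_sum measurable_fst.aemeasurable]
      simpa using hμ
    · rw [Measure.map_smul, Measure.map_finset_sum measurable_snd.aemeasurable]
      simp [empiricalMeasure]
    · refine lt_of_le_of_lt (le_of_eq ?_) hlt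
      rw [lintegral_smul_measure, lintegral_finsetSum_measure]
      congr 2
      refine Finset.sum_congr rfl fun i _ => ?_
      rw [lintegral_prod _ hcm.aemeasurable]
      simp

/-- The distance of `μ` to the empirical measure is a random variable. -/
theorem measurable_wassersteinDist_empiricalMeasure (hp : 1 ≤ p) (μ : Measure E)
    [IsProbabilityMeasure μ] (hμ : ∫⁻ x, ‖x‖ₑ ^ p ∂μ ≠ ∞) {n : ℕ} (hn : 1 ≤ n) :
    Measurable fun ω : ℕ → E => wassersteinDist p μ (empiricalMeasure n ω) := by
  -- The sublevel sets are even open: each is a union of open sets over all splittings of `μ`, so it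
  -- does not matter that the union is uncountable.
  refine measurable_of_Iio fun c => IsOpen.measurableSet ?_
  have : (fun ω : ℕ → E => wassersteinDist p μ (empiricalMeasure n ω)) ⁻¹' Set.Iio c =
      ⋃ κ : {κ : ℕ → Measure E // (∀ i, IsProbabilityMeasure (κ i)) ∧
        (n : ℝ≥0∞)⁻¹ • ∑ i ∈ Finset.range n, κ i = μ}, {ω : ℕ → E |
        ((n : ℝ≥0∞)⁻¹ * ∑ i ∈ Finset.range n, ∫⁻ x, edist x (ω i) ^ p ∂(κ.1 i)) ^ (1 / p) < c} := by
    ext ω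
    simp only [Set.mem_preimage, Set.mem_Iio, wassersteinDist_empiricalMeasure_lt_iff μ hn,
      Set.mem_iUnion, Set.mem_ofPred_eq, Subtype.exists, exists_prop, and_assoc]
  rw [this]
  refine isOpen_iUnion fun ⟨κ, hκ, hsum⟩ => ?_
  refine isOpen_lt ?_ continuous_const
  have hfin : ∀ i ∈ Finset.range n, ∫⁻ x, ‖x‖ₑ ^ p ∂(κ i) ≠ ∞ := by
    intro i hi h
    rw [← hsum, lintegral_smul_measure, lintegral_finsetSum_measure] at hμ
    have h2 : ∑ i ∈ Finset.range n, ∫⁻ x, ‖x‖ₑ ^ p ∂(κ i) = ∞ :=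
      ENNReal.sum_eq_top.2 ⟨i, hi, h⟩
    rw [h2] at hμ
    exact hμ (ENNReal.mul_top (by simp))
  refine ENNReal.continuous_rpow_const.comp ?_
  refine (ENNReal.continuous_const_mul (by simp; omega)).comp ?_
  refine continuous_finsetSum _ fun i hi => ?_
  have := hκ i
  exact (continuous_lintegral_edist_rpow hp (hfin i hi)).comp (continuous_apply i)

end Measurability

/-! ### Exponential maximal inequality -/

section Maximal

open ProbabilityTheory

/-- The third-order Taylor remainder `|x|^3 * exp |x|`, written as a relative correction to `x^2 /
2`. The correction vanishes at `0`, which preserves the sharp constant in the iterated logarithm. -/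
lemma exp_le_quadratic_add (x : ℝ) :
    Real.exp x ≤ 1 + x + x ^ 2 / 2 * (1 + 2 * |x| * Real.exp |x|) := by
  have h := Complex.norm_exp_sub_sum_le_norm_mul_exp (x : ℂ) 3
  have e : Complex.exp x - ∑ m ∈ Finset.range 3, (x : ℂ) ^ m / (m.factorial : ℂ)
      = ((Real.exp x - (1 + x + x ^ 2 / 2) : ℝ) : ℂ) := by
    simp [Finset.sum_range_succ, Nat.factorial]
  rw [e, Complex.norm_real, Complex.norm_real, Real.norm_eq_abs, Real.norm_eq_abs] at h
  have h2 := (le_abs_self _).trans h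
  have h3 : |x| ^ 3 = x ^ 2 * |x| := by rw [← sq_abs]; ring
  rw [h3] at h2
  linarith

variable {X : Type*} [MeasurableSpace X] {μ : Measure X} [IsProbabilityMeasure μ] {g : X → ℝ}
  {b v θ : ℝ}

lemma integrable_exp_mul_of_bounded (hg : Measurable g) (hb : ∀ x, |g x| ≤ b) (θ : ℝ) :
    Integrable (fun x => Real.exp (θ * g x)) μ := by
  refine Integrable.of_bound (by fun_prop) (Real.exp (|θ| * b)) (ae_of_all _ fun x => ?_)
  rw [Real.norm_eq_abs, Real.abs_exp, Real.exp_le_exp]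
  calc θ * g x ≤ |θ * g x| := le_abs_self _
    _ = |θ| * |g x| := abs_mul _ _
    _ ≤ |θ| * b := by gcongr; exact hb x

/-- Jensen's inequality in the form `1 + x ≤ exp x`; it turns the products of exponentials into a
submartingale. -/
lemma one_le_integral_exp (hg : Measurable g) (hb : ∀ x, |g x| ≤ b) (h0 : ∫ x, g x ∂μ = 0)
    (θ : ℝ) : 1 ≤ ∫ x, Real.exp (θ * g x) ∂μ := by
  have hgi : Integrable g μ := Integrable.of_bound (by fun_prop) b (ae_of_all _ hb)
  calc (1 : ℝ) = ∫ x, (θ * g x + 1) ∂μ := by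
        rw [integral_add (hgi.const_mul θ) (integrable_const _), integral_const_mul, h0]; simp
    _ ≤ _ := integral_mono ((hgi.const_mul θ).add (integrable_const _))
        (integrable_exp_mul_of_bounded hg hb θ) fun x => Real.add_one_le_exp _

/-- The bound for the logarithm of the moment generating function of a centred bounded variable. -/
noncomputable def expBound (v b θ : ℝ) : ℝ := v * θ ^ 2 / 2 * (1 + 2 * (θ * b) * Real.exp (θ * b))

/-- Integrating the quadratic bound kills the linear term, and `1 + x ≤ exp x` puts the result in
exponential form. -/
lemma integral_exp_le (hg : Measurable g) (hb : ∀ x, |g x| ≤ b) (h0 : ∫ x, g x ∂μ = 0)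
    (hv : ∫ x, g x ^ 2 ∂μ ≤ v) (hθ : 0 ≤ θ) :
    ∫ x, Real.exp (θ * g x) ∂μ ≤ Real.exp (expBound v b θ) := by
  have hgi : Integrable g μ := Integrable.of_bound (by fun_prop) b (ae_of_all _ hb)
  have hgi2 : Integrable (fun x => g x ^ 2) μ :=
    Integrable.of_bound (by fun_prop) (b ^ 2) (ae_of_all _ fun x => by
      rw [Real.norm_eq_abs, abs_pow]; exact pow_le_pow_left₀ (abs_nonneg _) (hb x) 2)
  have hb0 : 0 ≤ b := by
    obtain ⟨x⟩ : Nonempty X := by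
      by_contra h
      rw [not_nonempty_iff] at h
      exact IsProbabilityMeasure.ne_zero μ (Measure.eq_zero_of_isEmpty μ)
    exact (abs_nonneg _).trans (hb x)
  set K := θ ^ 2 / 2 * (1 + 2 * (θ * b) * Real.exp (θ * b)) with hK
  have hK0 : 0 ≤ K := by positivity
  calc ∫ x, Real.exp (θ * g x) ∂μ ≤ ∫ x, (1 + θ * g x + K * g x ^ 2) ∂μ := by
        refine integral_mono (integrable_exp_mul_of_bounded hg hb θ)
          (((integrable_const _).add (hgi.const_mul θ)).add (hgi2.const_mul K)) fun x => ?_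
        refine (exp_le_quadratic_add _).trans ?_
        have h1 : |θ * g x| ≤ θ * b := by
          rw [abs_mul, abs_of_nonneg hθ]; exact mul_le_mul_of_nonneg_left (hb x) hθ
        have h2 : (θ * g x) ^ 2 / 2 * (1 + 2 * |θ * g x| * Real.exp |θ * g x|)
            ≤ (θ * g x) ^ 2 / 2 * (1 + 2 * (θ * b) * Real.exp (θ * b)) := by gcongr
        have h3 : (θ * g x) ^ 2 / 2 * (1 + 2 * (θ * b) * Real.exp (θ * b)) = K * g x ^ 2 := by
          rw [hK]; ring
        linarith
    _ = 1 + K * ∫ x, g x ^ 2 ∂μ := by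
        have hi : Integrable (fun x => 1 + θ * g x) μ := (integrable_const _).add (hgi.const_mul θ)
        rw [integral_add hi (hgi2.const_mul K),
          integral_add (integrable_const _) (hgi.const_mul θ), integral_const_mul,
          integral_const_mul, h0]
        simp
    _ ≤ 1 + K * v := by gcongr
    _ = expBound v b θ + 1 := by rw [hK, expBound]; ring
    _ ≤ _ := Real.add_one_le_exp _

instance : IsProbabilityMeasure (iidLaw μ) := by unfold iidLaw; infer_instance

lemma integral_iidLaw_eval (f : X → ℝ) (hf : Measurable f) (i : ℕ) :
    ∫ ω, f (ω i) ∂(iidLaw μ) = ∫ x, f x ∂μ := by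
  have h := (measurePreserving_eval_infinitePi (fun _ : ℕ => μ) i).map_eq
  conv_rhs => rw [← h]
  rw [integral_map (measurable_pi_apply i).aemeasurable hf.aestronglyMeasurable]
  rfl

lemma lintegral_iidLaw_eval (f : X → ℝ≥0∞) (hf : Measurable f) (i : ℕ) :
    ∫⁻ ω, f (ω i) ∂(iidLaw μ) = ∫⁻ x, f x ∂μ :=
  (measurePreserving_eval_infinitePi (fun _ : ℕ => μ) i).lintegral_comp hf

lemma iIndepFun_iidLaw {Y : Type*} [MeasurableSpace Y] {f : X → Y} (hf : Measurable f) :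
    iIndepFun (fun (i : ℕ) (ω : ℕ → X) => f (ω i)) (iidLaw μ) :=
  iIndepFun_infinitePi (fun _ => hf)

lemma integral_exp_sum (hg : Measurable g) (θ : ℝ) (n : ℕ) :
    ∫ ω, Real.exp (θ * ∑ i ∈ Finset.range n, g (ω i)) ∂(iidLaw μ)
      = (∫ x, Real.exp (θ * g x) ∂μ) ^ n := by
  have h := (iIndepFun_iidLaw (μ := μ) hg).mgf_sum (t := θ) (fun i => by fun_prop)
    (Finset.range n)
  simp only [mgf] at h
  simp only [Finset.sum_apply] at h
  rw [h]
  rw [Finset.prod_congr rfl fun i _ => integral_iidLaw_eval (fun x => Real.exp (θ * g x))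
    (by fun_prop) i]
  simp

/-- Each new factor is independent of the past and has mean at least `1`. Index `n` carries `n + 1`
summands because the filtration at time `n` already knows the value of `g` at `ω n` through its
exponential. -/
lemma submartingale_exp_sum (hg : Measurable g) (hb : ∀ x, |g x| ≤ b) (h0 : ∫ x, g x ∂μ = 0)
    (θ : ℝ) :
    Submartingale (fun (n : ℕ) (ω : ℕ → X) => Real.exp (θ * ∑ i ∈ Finset.range (n + 1), g (ω i)))
      (Filtration.natural (fun (i : ℕ) (ω : ℕ → X) => Real.exp (θ * g (ω i)))
        (fun i => Measurable.stronglyMeasurable (by fun_prop))) (iidLaw μ) := by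
  set h : ℕ → (ℕ → X) → ℝ := fun i ω => Real.exp (θ * g (ω i)) with hh
  have hsm : ∀ i, StronglyMeasurable (h i) := fun i => Measurable.stronglyMeasurable (by fun_prop)
  have hprod : (fun (n : ℕ) (ω : ℕ → X) => Real.exp (θ * ∑ i ∈ Finset.range (n + 1), g (ω i)))
      = fun n => ∏ i ∈ Finset.range (n + 1), h i := by
    ext n ω
    rw [Finset.mul_sum, Real.exp_sum, Finset.prod_apply]
  have hint : ∀ n : ℕ, Integrable (fun ω : ℕ → X =>
      Real.exp (θ * ∑ i ∈ Finset.range (n + 1), g (ω i))) (iidLaw μ) := fun n => by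
    have hmeas : Measurable fun ω : ℕ → X =>
        Real.exp (θ * ∑ i ∈ Finset.range (n + 1), g (ω i)) := by fun_prop
    refine Integrable.of_bound hmeas.aestronglyMeasurable (Real.exp (|θ| * ((n + 1 : ℕ) * b)))
      (ae_of_all _ fun ω => ?_)
    rw [Real.norm_eq_abs, Real.abs_exp, Real.exp_le_exp]
    refine (le_abs_self _).trans ?_
    rw [abs_mul]
    gcongr
    refine (Finset.abs_sum_le_sum_abs _ _).trans ?_
    refine (Finset.sum_le_card_nsmul _ _ b fun i _ => hb _).trans ?_
    simp
  have hadp : StronglyAdapted (Filtration.natural h hsm)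
      (fun n => ∏ i ∈ Finset.range (n + 1), h i) := by
    intro n
    refine Finset.stronglyMeasurable_prod _ fun i hi => ?_
    exact (Filtration.stronglyAdapted_natural hsm i).mono
      ((Filtration.natural h hsm).mono (Nat.lt_succ_iff.1 (Finset.mem_range.1 hi)))
  rw [hprod]
  have hint' : ∀ n, Integrable (∏ i ∈ Finset.range (n + 1), h i) (iidLaw μ) := fun n => by
    have := hint n
    rwa [congrFun hprod n] at this
  refine submartingale_nat hadp hint' fun n => ?_
  have hI : iIndepFun h (iidLaw μ) :=
    iIndepFun_iidLaw (f := fun x => Real.exp (θ * g x)) (by fun_prop)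
  have h1 := condExp_mul_of_stronglyMeasurable_left (μ := iidLaw μ)
    (m := Filtration.natural h hsm n) (f := ∏ i ∈ Finset.range (n + 1), h i) (g := h (n + 1))
    (hadp n) (by rw [← Finset.prod_range_succ]; exact hint' (n + 1))
    (by
      refine Integrable.of_bound (hsm _).aestronglyMeasurable (Real.exp (|θ| * b))
        (ae_of_all _ fun ω => ?_)
      rw [Real.norm_eq_abs, Real.abs_exp, Real.exp_le_exp]
      refine (le_abs_self _).trans ?_
      rw [abs_mul]
      gcongr
      exact hb _)
  have h2 := hI.condExp_natural_ae_eq_of_lt hsm (Nat.lt_succ_self n)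
  have h3 : 1 ≤ ∫ ω, h (n + 1) ω ∂(iidLaw μ) := by
    rw [hh, integral_iidLaw_eval (fun x => Real.exp (θ * g x)) (by fun_prop)]
    exact one_le_integral_exp hg hb h0 θ
  rw [Finset.prod_range_succ _ (n + 1)]
  filter_upwards [h1, h2] with ω e1 e2
  rw [e1, Pi.mul_apply, e2]
  refine le_mul_of_one_le_right ?_ h3
  rw [Finset.prod_apply]
  exact Finset.prod_nonneg fun i _ => (Real.exp_pos _).le

/-- The exponential maximal inequality for partial sums of bounded centred variables. -/
theorem measure_exists_sum_ge_le (hg : Measurable g) (hb : ∀ x, |g x| ≤ b)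
    (h0 : ∫ x, g x ∂μ = 0) (hv : ∫ x, g x ^ 2 ∂μ ≤ v) (hθ : 0 ≤ θ) (N : ℕ) (a : ℝ) :
    iidLaw μ {ω | ∃ n, 1 ≤ n ∧ n ≤ N ∧ a ≤ ∑ i ∈ Finset.range n, g (ω i)} ≤
      ENNReal.ofReal (Real.exp (-(θ * a) + N * expBound v b θ)) := by
  rcases N.eq_zero_or_pos with rfl | hN
  · have : {ω : ℕ → X | ∃ n, 1 ≤ n ∧ n ≤ 0 ∧ a ≤ ∑ i ∈ Finset.range n, g (ω i)} = ∅ := by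
      ext ω; simp
    rw [this]; simp
  obtain ⟨N, rfl⟩ : ∃ M, N = M + 1 := ⟨N - 1, by omega⟩
  set f := fun (n : ℕ) (ω : ℕ → X) => Real.exp (θ * ∑ i ∈ Finset.range (n + 1), g (ω i)) with hf
  have hsub := submartingale_exp_sum (μ := μ) hg hb h0 θ
  set ε : NNReal := Real.toNNReal (Real.exp (θ * a))
  have hε : (ε : ℝ) = Real.exp (θ * a) := Real.coe_toNNReal _ (Real.exp_pos _).le
  -- Doob's inequality; the expectation over the exceedance event is then enlarged to the full one,
  -- which factorizes by independence.
  have hmax := maximal_ineq hsub (fun n ω => by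
    exact (Real.exp_pos _).le) (ε := ε) N
  set A := {ω : ℕ → X | (ε : ℝ) ≤ (Finset.range (N + 1)).sup' Finset.nonempty_range_add_one
    fun k => f k ω} with hA
  have hsubset : {ω : ℕ → X | ∃ n, 1 ≤ n ∧ n ≤ N + 1 ∧ a ≤ ∑ i ∈ Finset.range n, g (ω i)} ⊆ A := by
    rintro ω ⟨n, h1, h2, h3⟩
    obtain ⟨m, rfl⟩ : ∃ m, n = m + 1 := ⟨n - 1, by omega⟩
    refine le_trans ?_ (Finset.le_sup' (fun k => f k ω) (Finset.mem_range.2 (show m < N + 1 by omega)))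
    rw [hε]
    exact Real.exp_le_exp.2 (mul_le_mul_of_nonneg_left h3 hθ)
  have hfi : Integrable (f N) (iidLaw μ) := hsub.integrable N
  have hle : ∫ ω in A, f N ω ∂(iidLaw μ) ≤ Real.exp ((N + 1 : ℕ) * expBound v b θ) := by
    calc ∫ ω in A, f N ω ∂(iidLaw μ) ≤ ∫ ω, f N ω ∂(iidLaw μ) :=
          setIntegral_le_integral hfi (ae_of_all _ fun ω => (Real.exp_pos _).le)
      _ = (∫ x, Real.exp (θ * g x) ∂μ) ^ (N + 1) := integral_exp_sum hg θ (N + 1)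
      _ ≤ Real.exp (expBound v b θ) ^ (N + 1) := by
          gcongr
          exact integral_exp_le hg hb h0 hv hθ
      _ = _ := by rw [← Real.exp_nat_mul]
  have hmul : ENNReal.ofReal (Real.exp (θ * a)) * iidLaw μ A
      ≤ ENNReal.ofReal (Real.exp ((N + 1 : ℕ) * expBound v b θ)) := by
    exact hmax.trans (ENNReal.ofReal_le_ofReal hle)
  refine (measure_mono hsubset).trans ?_
  rw [Real.exp_add, Real.exp_neg, ENNReal.ofReal_mul (by positivity),
    ENNReal.ofReal_inv_of_pos (Real.exp_pos _)]
  rw [← ENNReal.div_eq_inv_mul, ENNReal.le_div_iff_mul_le (Or.inl (by simp [Real.exp_pos]))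
    (Or.inl (by simp)), mul_comm]
  exact hmul

end Maximal

/-! ### The truncated iterated logarithm -/

section LogTwo

open Topology

lemma one_le_loglog {x : ℝ} (hx : Real.exp (Real.exp 1) ≤ x) : 1 ≤ Real.log (Real.log x) := by
  have h1 : Real.exp 1 ≤ Real.log x := (Real.le_log_iff_exp_le ((Real.exp_pos _).trans_le hx)).2 hx
  exact (Real.le_log_iff_exp_le ((Real.exp_pos _).trans_le h1)).2 h1

lemma one_le_logTwo (x : ℝ) : 1 ≤ logTwo x := by
  unfold logTwo
  split_ifs with h
  · exact le_rfl
  · exact one_le_loglog (not_lt.1 h)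

lemma logTwo_pos (x : ℝ) : 0 < logTwo x := zero_lt_one.trans_le (one_le_logTwo x)

lemma logTwo_mono : Monotone logTwo := by
  intro x y hxy
  by_cases hx : x < Real.exp (Real.exp 1)
  · rw [show logTwo x = 1 by simp [logTwo, hx]]
    exact one_le_logTwo y
  · have hy : ¬ y < Real.exp (Real.exp 1) := fun h => hx (hxy.trans_lt h)
    simp only [logTwo, hx, hy, if_false]
    have h0 : 0 < x := (Real.exp_pos _).trans_le (not_lt.1 hx)
    have h1 : Real.exp 1 ≤ Real.log x := (Real.le_log_iff_exp_le h0).2 (not_lt.1 hx)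
    exact Real.log_le_log ((Real.exp_pos _).trans_le h1) (Real.log_le_log h0 hxy)

lemma loglog_le_logTwo {x : ℝ} (hx : 1 < x) : Real.log (Real.log x) ≤ logTwo x := by
  unfold logTwo
  split_ifs with h
  · have h1 : Real.log x < Real.exp 1 := (Real.log_lt_iff_lt_exp (by linarith)).2 h
    exact ((Real.log_lt_iff_lt_exp (Real.log_pos hx)).2 h1).le
  · exact le_rfl

lemma logTwo_le_one_add_log {x : ℝ} (hx : 1 ≤ x) : logTwo x ≤ 1 + Real.log x := by
  have h0 := Real.log_nonneg hx
  unfold logTwo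
  split_ifs with h
  · linarith
  · have := Real.log_le_self h0
    linarith

lemma tendsto_logTwo_div_atTop : Tendsto (fun x => logTwo x / x) atTop (𝓝 0) := by
  have h1 : Tendsto (fun x : ℝ => 1 / x + Real.log x / x) atTop (𝓝 0) := by
    have h2 : Tendsto (fun x : ℝ => Real.log x / x) atTop (𝓝 0) :=
      Real.isLittleO_log_id_atTop.tendsto_div_nhds_zero
    have h3 : Tendsto (fun x : ℝ => 1 / x) atTop (𝓝 0) := by
      simpa using tendsto_inv_atTop_zero (𝕜 := ℝ)
    simpa using h3.add h2
  refine tendsto_of_tendsto_of_tendsto_of_le_of_le' tendsto_const_nhds h1 ?_ ?_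
  · filter_upwards [eventually_ge_atTop 1] with x hx
    have := logTwo_pos x
    positivity
  · filter_upwards [eventually_ge_atTop 1] with x hx
    rw [← add_div]
    gcongr
    exact logTwo_le_one_add_log hx

/-- For `k ≥ 1`, `Log₂ (ρ^k) ≥ log k + log (log ρ)`, so the terms are at most a multiple of
`k^(-κ)`. -/
lemma summable_exp_neg_logTwo {ρ κ : ℝ} (hρ : 1 < ρ) (hκ : 1 < κ) :
    Summable fun k : ℕ => Real.exp (-(κ * logTwo (ρ ^ k))) := by
  have hs : Summable fun k : ℕ => (Real.log ρ) ^ (-κ) * (k : ℝ) ^ (-κ) :=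
    (Real.summable_nat_rpow.2 (by linarith)).mul_left _
  refine Summable.of_norm_bounded_eventually_nat hs ?_
  filter_upwards [eventually_ge_atTop 1] with k hk
  have hk0 : (0 : ℝ) < k := by exact_mod_cast hk
  have hl := Real.log_pos hρ
  have h1 : Real.log (Real.log (ρ ^ k)) ≤ logTwo (ρ ^ k) :=
    loglog_le_logTwo (one_lt_pow₀ hρ (by omega))
  rw [Real.log_pow] at h1
  rw [Real.norm_eq_abs, Real.abs_exp, ← Real.mul_rpow hl.le hk0.le, mul_comm (Real.log ρ),
    Real.rpow_def_of_pos (by positivity)]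
  refine Real.exp_le_exp.2 ?_
  nlinarith

end LogTwo

/-! ### Law of the iterated logarithm, upper half -/

section IteratedLogarithm

open Topology

variable {X : Type*} [MeasurableSpace X] {μ : Measure X} [IsProbabilityMeasure μ] {g : X → ℝ}
  {b v : ℝ}

/-- The upper half of the law of the iterated logarithm for bounded variables. -/
theorem ae_eventually_sum_le (hg : Measurable g) (hb : ∀ x, |g x| ≤ b)
    (h0 : ∫ x, g x ∂μ = 0) (hv : ∫ x, g x ^ 2 ∂μ ≤ v) (hv0 : 0 < v) {κ : ℝ} (hκ : 1 < κ) :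
    ∀ᵐ ω ∂(iidLaw μ), ∀ᶠ n : ℕ in atTop,
      ∑ i ∈ Finset.range n, g (ω i) ≤ κ * √(2 * v * (n * logTwo n)) := by
  -- Blocks of ratio `ρ` strictly between `1` and `κ` leave room for both the block length and the
  -- correction in `expBound`.
  set ρ := (1 + κ) / 2 with hρ
  have hρ1 : 1 < ρ := by rw [hρ]; linarith
  have hρκ : ρ < κ := by rw [hρ]; linarith
  have hρ0 : 0 < ρ := by linarith
  set L : ℕ → ℝ := fun k => logTwo (ρ ^ k) with hL
  have hL0 : ∀ k, 0 < L k := fun k => logTwo_pos _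
  -- This minimizes `-θ a + N v θ^2 / 2` for `N = ρ^k` and `a = √(2 v ρ^k L k)`. On block `k` the
  -- gain is `2 κ L k` and the cost `ρ (1 + o(1)) L k ≤ κ L k`, leaving the summable `exp (-κ L k)`
  -- for Borel–Cantelli.
  set θ : ℕ → ℝ := fun k => √(2 * L k / (v * ρ ^ k)) with hθ
  set a : ℕ → ℝ := fun k => κ * √(2 * v * (ρ ^ k * L k)) with ha
  have hθ0 : Tendsto θ atTop (𝓝 0) := by
    have h1 : Tendsto (fun k : ℕ => logTwo (ρ ^ k) / ρ ^ k) atTop (𝓝 0) :=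
      tendsto_logTwo_div_atTop.comp (tendsto_pow_atTop_atTop_of_one_lt hρ1)
    have h2 : Tendsto (fun k : ℕ => √(2 / v * (logTwo (ρ ^ k) / ρ ^ k))) atTop
        (𝓝 √(2 / v * 0)) := (Real.continuous_sqrt.tendsto _).comp (h1.const_mul _)
    rw [mul_zero, Real.sqrt_zero] at h2
    refine h2.congr fun k => ?_
    simp only [hθ, hL]
    congr 1
    field_simp
  have hev : ∀ᶠ k in atTop, ρ * (1 + 2 * (θ k * b) * Real.exp (θ k * b)) ≤ κ := by
    have hc : Continuous fun t : ℝ => ρ * (1 + 2 * (t * b) * Real.exp (t * b)) := by fun_prop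
    have h1 := (hc.tendsto 0).comp hθ0
    simp only [zero_mul, mul_zero, add_zero, mul_one] at h1
    exact (h1.eventually (Iio_mem_nhds hρκ)).mono fun k hk => le_of_lt hk
  set A : ℕ → Set (ℕ → X) := fun k =>
    {ω | ∃ n, 1 ≤ n ∧ n ≤ ⌊ρ ^ (k + 1)⌋₊ ∧ a k ≤ ∑ i ∈ Finset.range n, g (ω i)} with hA
  have hP : ∀ᶠ k in atTop, iidLaw μ (A k) ≤ ENNReal.ofReal (Real.exp (-(κ * L k))) := by
    filter_upwards [hev] with k hk
    refine (measure_exists_sum_ge_le (θ := θ k) hg hb h0 hv (Real.sqrt_nonneg _) ⌊ρ ^ (k + 1)⌋₊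
      (a k)).trans ?_
    refine ENNReal.ofReal_le_ofReal (Real.exp_le_exp.2 ?_)
    have hx : 0 < ρ ^ k := by positivity
    have e1 : θ k * a k = 2 * κ * L k := by
      have : √(2 * L k / (v * ρ ^ k)) * √(2 * v * (ρ ^ k * L k)) = 2 * L k := by
        rw [← Real.sqrt_mul (by have := hL0 k; positivity)]
        rw [show 2 * L k / (v * ρ ^ k) * (2 * v * (ρ ^ k * L k)) = (2 * L k) ^ 2 by field_simp]
        exact Real.sqrt_sq (by have := hL0 k; positivity)
      simp only [hθ, ha]
      linear_combination κ * this
    have e2 : θ k ^ 2 = 2 * L k / (v * ρ ^ k) := Real.sq_sqrt (by have := hL0 k; positivity)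
    have hb0 : 0 ≤ θ k * b := by
      refine mul_nonneg (Real.sqrt_nonneg _) ?_
      obtain ⟨x⟩ : Nonempty X := by
        by_contra h
        rw [not_nonempty_iff] at h
        exact IsProbabilityMeasure.ne_zero μ (Measure.eq_zero_of_isEmpty μ)
      exact (abs_nonneg _).trans (hb x)
    have e3 : (⌊ρ ^ (k + 1)⌋₊ : ℝ) * expBound v b (θ k)
        ≤ L k * (ρ * (1 + 2 * (θ k * b) * Real.exp (θ k * b))) := by
      have hN : (⌊ρ ^ (k + 1)⌋₊ : ℝ) ≤ ρ ^ (k + 1) := Nat.floor_le (by positivity)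
      have h1 : 0 ≤ expBound v b (θ k) := by unfold expBound; positivity
      calc (⌊ρ ^ (k + 1)⌋₊ : ℝ) * expBound v b (θ k) ≤ ρ ^ (k + 1) * expBound v b (θ k) := by
            gcongr
        _ = _ := by
            unfold expBound
            rw [e2, pow_succ]
            field_simp
    have e4 : L k * (ρ * (1 + 2 * (θ k * b) * Real.exp (θ k * b))) ≤ L k * κ :=
      mul_le_mul_of_nonneg_left hk (hL0 k).le
    rw [e1]
    linarith
  obtain ⟨k₀, hk₀⟩ := eventually_atTop.1 hP
  have hsum : ∑' k, iidLaw μ (A (k + k₀)) ≠ ∞ :=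
    ne_top_of_le_ne_top
      ((summable_nat_add_iff k₀).2 (summable_exp_neg_logTwo hρ1 hκ)).tsum_ofReal_ne_top
      (ENNReal.tsum_le_tsum fun k => hk₀ (k + k₀) (by omega))
  filter_upwards [ae_eventually_notMem hsum] with ω hω
  obtain ⟨k₁, hk₁⟩ := eventually_atTop.1 hω
  obtain ⟨n₀, hn₀⟩ := exists_nat_ge (ρ ^ (k₁ + k₀ + 1))
  filter_upwards [eventually_ge_atTop (max n₀ 1)] with n hn
  have hn1 : 1 ≤ n := (le_max_right _ _).trans hn
  have hn1' : (1 : ℝ) ≤ n := by exact_mod_cast hn1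
  obtain ⟨k, hk1, hk2⟩ := exists_nat_pow_near hn1' hρ1
  have hkk : k₁ + k₀ ≤ k := by
    have h1 : ρ ^ (k₁ + k₀ + 1) ≤ n := hn₀.trans (by exact_mod_cast (le_max_left _ _).trans hn)
    have h2 := (pow_lt_pow_iff_right₀ hρ1).1 (h1.trans_lt hk2)
    omega
  have := hk₁ (k - k₀) (by omega)
  rw [Nat.sub_add_cancel (by omega)] at this
  simp only [hA, Set.mem_ofPred_eq, not_exists, not_and, not_le] at this
  refine (this n hn1 (Nat.le_floor hk2.le)).le.trans ?_
  simp only [ha]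
  have := hL0 k
  have hLn : L k ≤ logTwo n := logTwo_mono hk1
  gcongr

end IteratedLogarithm

/-! ### Mean of the supremum of normalized partial sums -/

section UniformBound

variable {X : Type*} [MeasurableSpace X] {μ : Measure X} [IsProbabilityMeasure μ] {g : X → ℝ}
  {b v θ q s : ℝ}

lemma lintegral_exp_neg_mul_Ioi (hθ : 0 < θ) :
    ∫⁻ t in Set.Ioi (0 : ℝ), ENNReal.ofReal (Real.exp (-θ * t)) = ENNReal.ofReal (1 / θ) := by
  rw [← ofReal_integral_eq_lintegral_ofReal (integrableOn_exp_mul_Ioi (by linarith) 0)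
    (ae_of_all _ fun t => (Real.exp_pos _).le), integral_exp_mul_Ioi (by linarith)]
  simp

/-- The mean excess of the running maximum of the partial sums over a level `c`. -/
lemma exists_lintegral_excess_le (hg : Measurable g) (hb : ∀ x, |g x| ≤ b)
    (h0 : ∫ x, g x ∂μ = 0) (hv : ∫ x, g x ^ 2 ∂μ ≤ v) (hθ : 0 < θ) (N : ℕ) {c : ℝ} (hc : 0 ≤ c) :
    ∃ U : (ℕ → X) → ℝ≥0∞, Measurable U ∧
      (∀ ω n, 1 ≤ n → n ≤ N → ENNReal.ofReal (∑ i ∈ Finset.range n, g (ω i) - c) ≤ U ω) ∧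
      ∫⁻ ω, U ω ∂(iidLaw μ)
        ≤ ENNReal.ofReal (Real.exp (-(θ * c) + N * expBound v b θ) / θ) := by
  set u : (ℕ → X) → ℝ := fun ω => (Finset.range (N + 1)).sup' Finset.nonempty_range_add_one
    (fun n => max (∑ i ∈ Finset.range n, g (ω i) - c) 0) with hu
  have hum : Measurable u := by
    have : Measurable ((Finset.range (N + 1)).sup' Finset.nonempty_range_add_one
      (fun n (ω : ℕ → X) => max (∑ i ∈ Finset.range n, g (ω i) - c) 0)) :=
      Finset.measurable_sup' _ fun n _ => by fun_prop
    convert this using 1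
    ext ω
    rw [Finset.sup'_apply]
  have hle : ∀ ω n, n ≤ N → max (∑ i ∈ Finset.range n, g (ω i) - c) 0 ≤ u ω := fun ω n hn =>
    Finset.le_sup' (fun n => max (∑ i ∈ Finset.range n, g (ω i) - c) 0)
      (Finset.mem_range.2 (by omega))
  have hu0 : ∀ ω, 0 ≤ u ω := fun ω => (le_max_right _ _).trans (hle ω 0 (Nat.zero_le _))
  refine ⟨fun ω => ENNReal.ofReal (u ω), hum.ennreal_ofReal, fun ω n _ hn =>
    ENNReal.ofReal_le_ofReal ((le_max_left _ _).trans (hle ω n hn)), ?_⟩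
  -- Layer cake: exceeding the level by a further `t` costs a factor `exp (-θ t)`, which integrates
  -- to `1 / θ`.
  rw [lintegral_eq_lintegral_meas_lt _ (ae_of_all _ hu0) hum.aemeasurable]
  set B := Real.exp (-(θ * c) + N * expBound v b θ) with hB
  calc ∫⁻ t in Set.Ioi (0 : ℝ), iidLaw μ {ω | t < u ω}
      ≤ ∫⁻ t in Set.Ioi (0 : ℝ), ENNReal.ofReal B * ENNReal.ofReal (Real.exp (-θ * t)) := by
        refine setLIntegral_mono' measurableSet_Ioi fun t ht => ?_
        have ht0 : 0 < t := ht
        have hsub : {ω | t < u ω} ⊆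
            {ω | ∃ n, 1 ≤ n ∧ n ≤ N ∧ c + t ≤ ∑ i ∈ Finset.range n, g (ω i)} := by
          intro ω hω
          obtain ⟨n, hn, hlt⟩ := (Finset.lt_sup'_iff _).1 (show t < u ω from hω)
          have h1 : t < ∑ i ∈ Finset.range n, g (ω i) - c := by
            rcases lt_max_iff.1 hlt with h | h
            · exact h
            · linarith
          refine ⟨n, ?_, by have := Finset.mem_range.1 hn; omega, by linarith⟩
          rcases n.eq_zero_or_pos with rfl | h
          · simp at h1; linarith
          · exact h
        refine (measure_mono hsub).trans
          ((measure_exists_sum_ge_le hg hb h0 hv hθ.le N (c + t)).trans (le_of_eq ?_))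
        rw [hB, ← ENNReal.ofReal_mul (Real.exp_pos _).le, ← Real.exp_add]
        congr 2; ring
    _ = _ := by
        rw [lintegral_const_mul _ (by fun_prop), lintegral_exp_neg_mul_Ioi hθ,
          ← ENNReal.ofReal_mul (Real.exp_pos _).le]
        congr 1; ring

/-- The factor by which a dyadic block of indices contributes to the uniform bound. -/
noncomputable def blockFactor (s : ℝ) (k : ℕ) : ℝ :=
  2 * Real.exp (-(2 * logTwo (2 ^ k))) + 4 * ((2 : ℝ) ^ k) ^ (s - 1 / 2)

lemma blockFactor_nonneg (s : ℝ) (k : ℕ) : 0 ≤ blockFactor s k := by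
  unfold blockFactor; positivity

lemma summable_blockFactor (hs : s < 1 / 2) : Summable (blockFactor s) := by
  refine Summable.add ((summable_exp_neg_logTwo one_lt_two one_lt_two).mul_left 2)
    (Summable.mul_left 4 ?_)
  have h : Summable fun k : ℕ => ((2 : ℝ) ^ (s - 1 / 2)) ^ k :=
    summable_geometric_of_lt_one (by positivity)
      (Real.rpow_lt_one_of_one_lt_of_neg one_lt_two (by linarith))
  refine h.congr fun k => ?_
  rw [← Real.rpow_natCast, ← Real.rpow_natCast, ← Real.rpow_mul (by norm_num),
    ← Real.rpow_mul (by norm_num), mul_comm]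

lemma sqrt_le_rpow (hq0 : 0 ≤ q) (hq1 : q ≤ 1) (hs0 : 0 < s) (hs : s ≤ 1 / 2) : √q ≤ q ^ s := by
  rcases hq0.eq_or_lt with rfl | hq
  · simp [Real.zero_rpow hs0.ne']
  · rw [Real.sqrt_eq_rpow]
    exact Real.rpow_le_rpow_of_exponent_ge hq hq1 hs

/-- The quotient of the two sides is `(y q)^(1 - s) ≤ 1`. This serves the blocks with at most about
one expected hit, where a first moment suffices. -/
lemma sparse_block_le {y : ℝ} (hq0 : 0 ≤ q) (hs0 : 0 < s) (hs : s < 1 / 2) (hy : 0 < y)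
    (hx : y * q ≤ 1) : √y * q ≤ q ^ s * y ^ (s - 1 / 2) := by
  have h1 : q ^ s * q ^ (1 - s) = q := by
    rw [← Real.rpow_add_of_nonneg hq0 hs0.le (by linarith)]; simp
  have h2 : y ^ (s - 1 / 2) * y ^ (1 - s) = √y := by
    rw [← Real.rpow_add hy, Real.sqrt_eq_rpow]; congr 1; ring
  have h3 : (y * q) ^ (1 - s) ≤ 1 := Real.rpow_le_one (by positivity) hx (by linarith)
  rw [Real.mul_rpow hy.le hq0] at h3
  calc √y * q = (q ^ s * y ^ (s - 1 / 2)) * (y ^ (1 - s) * q ^ (1 - s)) := by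
        conv_lhs => rw [← h1, ← h2]
        ring
    _ ≤ (q ^ s * y ^ (s - 1 / 2)) * 1 := by gcongr
    _ = _ := mul_one _

/-- Since `e < 3`, the bracket in `expBound` is at most `1 + 2 * 3 ≤ 8`. -/
lemma expBound_one_le (hq0 : 0 ≤ q) (hθ0 : 0 ≤ θ) (hθ1 : θ ≤ 1) :
    expBound q 1 θ ≤ 4 * q * θ ^ 2 := by
  have h1 : Real.exp (θ * 1) ≤ 3 :=
    (Real.exp_le_exp.2 (by linarith)).trans (Real.exp_one_lt_d9.le.trans (by norm_num))
  have h2 : 2 * (θ * 1) * Real.exp (θ * 1) ≤ 2 * 1 * 3 := by gcongr; linarith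
  unfold expBound
  calc q * θ ^ 2 / 2 * (1 + 2 * (θ * 1) * Real.exp (θ * 1)) ≤ q * θ ^ 2 / 2 * 8 := by
        gcongr; linarith
    _ = _ := by ring

/-- The choice of the exponential parameter on a block where at least one success is expected. -/
lemma exists_dense_block_le (k : ℕ) (hq0 : 0 < q) (hq1 : q ≤ 1) (hs0 : 0 < s) (hs : s < 1 / 2)
    (hx : 1 ≤ 2 ^ k * q) :
    ∃ θ, 0 < θ ∧
      1 / √(2 ^ k * logTwo (2 ^ k)) * (Real.exp (-(θ * (10 * √q * √(2 ^ k * logTwo (2 ^ k)))) +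
        (2 ^ (k + 1) : ℕ) * expBound q 1 θ) / θ)
      ≤ q ^ s * (Real.exp (-(2 * logTwo (2 ^ k))) + ((2 : ℝ) ^ k) ^ (s - 1 / 2)) := by
  set y : ℝ := 2 ^ k with hy
  set L := logTwo y with hL
  have hL1 : 1 ≤ L := one_le_logTwo _
  have hL0 : 0 < L := logTwo_pos _
  have hy0 : 0 < y := by positivity
  have hN : ((2 ^ (k + 1) : ℕ) : ℝ) = 2 * y := by push_cast; rw [pow_succ, hy]; ring
  have hsq : √q ≤ q ^ s := sqrt_le_rpow hq0.le hq1 hs0 hs.le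
  have hqs : 0 < q ^ s := by positivity
  have hys : 0 < y ^ (s - 1 / 2) := by positivity
  have hD : 0 < √(y * L) := by positivity
  have hqD : √q * √(y * L) = √((y * q) * L) := by
    rw [← Real.sqrt_mul hq0.le]; congr 1; ring
  rcases le_or_gt L (y * q) with h | h
  -- Gaussian range. The level with constant `10` yields a gain `10 L` against a cost of at most `8
  -- L`; the surplus gives `exp (-2 L)`, summable over the blocks.
  · set θ := √(L / (y * q)) with hθ
    have hθ0 : 0 < θ := by positivity
    have hθ1 : θ ≤ 1 := by
      exact Real.sqrt_le_one.2 ((div_le_one (by positivity)).2 h)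
    have hθ2 : θ ^ 2 = L / (y * q) := Real.sq_sqrt (by positivity)
    have e1 : θ * (10 * √q * √(y * L)) = 10 * L := by
      have : θ * (√q * √(y * L)) = L := by
        rw [hqD, hθ, ← Real.sqrt_mul (by positivity),
          show L / (y * q) * (y * q * L) = L ^ 2 by field_simp, Real.sqrt_sq hL0.le]
      linear_combination 10 * this
    have e2 : 2 * y * expBound q 1 θ ≤ 8 * L := by
      calc 2 * y * expBound q 1 θ ≤ 2 * y * (4 * q * θ ^ 2) := by
            gcongr; exact expBound_one_le hq0.le hθ0.le hθ1
        _ = 8 * L := by rw [hθ2]; field_simp; ring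
    have e3 : 1 / √(y * L) * (1 / θ) ≤ √q := by
      have : √(y * L) * θ * √q = L := by
        rw [mul_comm _ θ, mul_assoc, mul_comm _ (√q)]; linear_combination e1 / 10
      rw [one_div_mul_one_div, div_le_iff₀ (by positivity)]
      linarith
    refine ⟨θ, hθ0, ?_⟩
    rw [hN, e1]
    calc 1 / √(y * L) * (Real.exp (-(10 * L) + 2 * y * expBound q 1 θ) / θ)
        ≤ 1 / √(y * L) * (Real.exp (-(2 * L)) / θ) := by
          gcongr; linarith
      _ = (1 / √(y * L) * (1 / θ)) * Real.exp (-(2 * L)) := by ring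
      _ ≤ √q * Real.exp (-(2 * L)) := by gcongr
      _ ≤ q ^ s * (Real.exp (-(2 * L)) + y ^ (s - 1 / 2)) := by
          gcongr; linarith
  -- Poisson range `1 ≤ y q < L`. With `θ = 1` the exponent is at most `8 y q - 10 y q ≤ 0`, and the
  -- prefactor `1 / √(y L)` alone is small enough because `(y q)^s ≥ 1`.
  · refine ⟨1, one_pos, ?_⟩
    have e1 : 2 * y * expBound q 1 1 ≤ 8 * (y * q) := by
      calc 2 * y * expBound q 1 1 ≤ 2 * y * (4 * q * 1 ^ 2) := by
            gcongr; exact expBound_one_le hq0.le zero_le_one le_rfl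
        _ = _ := by ring
    have e2 : y * q ≤ √q * √(y * L) := by
      rw [hqD]
      refine Real.le_sqrt_of_sq_le ?_
      rw [sq]; gcongr
    have e3 : Real.exp (-(1 * (10 * √q * √(y * L))) + 2 * y * expBound q 1 1) ≤ 1 := by
      rw [Real.exp_le_one_iff]
      nlinarith
    have e4 : 1 / √(y * L) ≤ q ^ s * y ^ (s - 1 / 2) := by
      have h1 : y ^ (s - 1 / 2) = y ^ s * (1 / √y) := by
        rw [Real.rpow_sub hy0, Real.sqrt_eq_rpow]; ring
      have h2 : 1 ≤ q ^ s * y ^ s := by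
        rw [← Real.mul_rpow hq0.le hy0.le, mul_comm q]
        exact Real.one_le_rpow hx hs0.le
      rw [h1, ← mul_assoc]
      calc 1 / √(y * L) ≤ 1 / √y := by
            gcongr; nlinarith
        _ ≤ (q ^ s * y ^ s) * (1 / √y) := le_mul_of_one_le_left (by positivity) h2
    rw [hN]
    calc 1 / √(y * L) * (Real.exp (-(1 * (10 * √q * √(y * L))) + 2 * y * expBound q 1 1) / 1)
        ≤ 1 / √(y * L) * (1 / 1) := by gcongr
      _ ≤ q ^ s * y ^ (s - 1 / 2) := by simpa using e4
      _ ≤ _ := by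
        gcongr
        have := Real.exp_pos (-(2 * L))
        linarith

/-- The contribution of a dyadic block of indices. -/
lemma exists_block_bound (hg : Measurable g) (hb : ∀ x, |g x| ≤ 1) (h0 : ∫ x, g x ∂μ = 0)
    (hv : ∫ x, g x ^ 2 ∂μ ≤ q) (h1 : ∫ x, |g x| ∂μ ≤ 2 * q) (hq1 : q ≤ 1)
    (hs0 : 0 < s) (hs : s < 1 / 2) (k : ℕ) :
    ∃ R : (ℕ → X) → ℝ≥0∞, Measurable R ∧
      (∀ ω (n : ℕ), 2 ^ k ≤ n → n < 2 ^ (k + 1) →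
        ENNReal.ofReal (|∑ i ∈ Finset.range n, g (ω i)| / √(n * logTwo n))
          ≤ ENNReal.ofReal (10 * √q) + R ω) ∧
      ∫⁻ ω, R ω ∂(iidLaw μ) ≤ ENNReal.ofReal (q ^ s * blockFactor s k) := by
  have hq0 : 0 ≤ q := le_trans (integral_nonneg fun x => sq_nonneg _) hv
  set y : ℝ := 2 ^ k with hy
  have hy0 : 0 < y := by positivity
  set L := logTwo y with hL
  have hL1 : 1 ≤ L := one_le_logTwo _
  set D := √(y * L) with hD
  have hD0 : 0 < D := by positivity
  have hDn : ∀ n : ℕ, 2 ^ k ≤ n → D ≤ √(n * logTwo n) := by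
    intro n hn
    have hyn : y ≤ n := by rw [hy]; exact_mod_cast hn
    have := logTwo_mono hyn
    exact Real.sqrt_le_sqrt (by gcongr)
  rcases le_or_gt (y * q) 1 with hx | hx
  -- At most about one expected hit: all sums in the block are dominated by the sum of the absolute
  -- values up to its end, each of mean at most `2 q`.
  · refine ⟨fun ω => ENNReal.ofReal (1 / D) *
      ∑ i ∈ Finset.range (2 ^ (k + 1)), ENNReal.ofReal |g (ω i)|, by fun_prop, ?_, ?_⟩
    · intro ω n hn1 hn2
      refine le_add_left ?_
      simp only
      rw [← ENNReal.ofReal_sum_of_nonneg fun _ _ => abs_nonneg _,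
        ← ENNReal.ofReal_mul (by positivity)]
      refine ENNReal.ofReal_le_ofReal ?_
      rw [div_eq_mul_one_div, mul_comm]
      gcongr
      · exact hDn n hn1
      · refine (Finset.abs_sum_le_sum_abs _ _).trans ?_
        exact Finset.sum_le_sum_of_subset_of_nonneg
          (Finset.range_subset_range.2 hn2.le) fun _ _ _ => abs_nonneg _
    · rw [lintegral_const_mul _ (by fun_prop), lintegral_finsetSum _ (by fun_prop)]
      have e1 : ∀ i : ℕ, ∫⁻ ω, ENNReal.ofReal |g (ω i)| ∂(iidLaw μ) ≤ ENNReal.ofReal (2 * q) := by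
        intro i
        rw [lintegral_iidLaw_eval (fun x => ENNReal.ofReal |g x|) (by fun_prop),
          ← ofReal_integral_eq_lintegral_ofReal
            (Integrable.of_bound (by fun_prop) 1 (ae_of_all _ fun x => by simpa using hb x))
            (ae_of_all _ fun x => abs_nonneg _)]
        exact ENNReal.ofReal_le_ofReal h1
      calc ENNReal.ofReal (1 / D) * ∑ i ∈ Finset.range (2 ^ (k + 1)),
            ∫⁻ ω, ENNReal.ofReal |g (ω i)| ∂(iidLaw μ)
          ≤ ENNReal.ofReal (1 / D) * ∑ i ∈ Finset.range (2 ^ (k + 1)), ENNReal.ofReal (2 * q) := by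
            gcongr with i hi; exact e1 i
        _ = ENNReal.ofReal (1 / D * (2 * y * (2 * q))) := by
            rw [Finset.sum_const, Finset.card_range, nsmul_eq_mul,
              ENNReal.ofReal_mul (p := 1 / D) (by positivity),
              ENNReal.ofReal_mul (p := 2 * y) (by positivity)]
            congr 2
            rw [← ENNReal.ofReal_natCast]
            congr 1
            push_cast; rw [pow_succ, hy]; ring
        _ ≤ _ := by
            refine ENNReal.ofReal_le_ofReal ?_
            have h2 : 1 / D ≤ 1 / √y := by
              gcongr; rw [hD]; exact Real.sqrt_le_sqrt (by nlinarith)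
            have h3 : 1 / √y * y = √y := by
              rw [one_div_mul_eq_div, Real.div_sqrt]
            calc 1 / D * (2 * y * (2 * q)) ≤ 1 / √y * (2 * y * (2 * q)) := by gcongr
              _ = 4 * (1 / √y * y * q) := by ring
              _ = 4 * (√y * q) := by rw [h3]
              _ ≤ 4 * (q ^ s * y ^ (s - 1 / 2)) := by
                  exact mul_le_mul_of_nonneg_left (sparse_block_le hq0 hs0 hs hy0 hx) (by norm_num)
              _ = q ^ s * (4 * y ^ (s - 1 / 2)) := by ring
              _ ≤ _ := by
                  unfold blockFactor
                  gcongr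
                  have := Real.exp_pos (-(2 * logTwo (2 ^ k)))
                  linarith
  · have hq : 0 < q := by
      by_contra h
      have : q = 0 := le_antisymm (not_lt.1 h) hq0
      rw [this] at hx; simp at hx; linarith
    obtain ⟨θ, hθ0, hθ⟩ := exists_dense_block_le k hq hq1 hs0 hs hx.le
    rw [← hy, ← hL, ← hD] at hθ
    set c := 10 * √q * D with hc
    have hc0 : 0 ≤ c := by positivity
    obtain ⟨U, hUm, hU, hUi⟩ := exists_lintegral_excess_le hg hb h0 hv hθ0 (2 ^ (k + 1)) hc0
    obtain ⟨V, hVm, hV, hVi⟩ := exists_lintegral_excess_le (μ := μ) (g := fun x => -g x) (v := q)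
      (b := 1) hg.neg (fun x => by rw [abs_neg]; exact hb x) (by rw [integral_neg, h0, neg_zero])
      (by simpa using hv) hθ0 (2 ^ (k + 1)) hc0
    refine ⟨fun ω => ENNReal.ofReal (1 / D) * (U ω + V ω), by fun_prop, ?_, ?_⟩
    · intro ω n hn1 hn2
      have hn : 1 ≤ n := Nat.one_le_two_pow.trans hn1
      set S := ∑ i ∈ Finset.range n, g (ω i) with hS
      have hVS := hV ω n hn hn2.le
      rw [Finset.sum_neg_distrib, ← hS] at hVS
      have hUV : ENNReal.ofReal (|S| - c) ≤ U ω + V ω := by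
        rcases abs_cases S with ⟨h, _⟩ | ⟨h, _⟩ <;> rw [h]
        · exact (hU ω n hn hn2.le).trans le_self_add
        · exact hVS.trans le_add_self
      calc ENNReal.ofReal (|S| / √(n * logTwo n)) ≤ ENNReal.ofReal (10 * √q + 1 / D * (|S| - c)) := by
            refine ENNReal.ofReal_le_ofReal ?_
            calc |S| / √(n * logTwo n) ≤ |S| / D := by gcongr; exact hDn n hn1
              _ = _ := by rw [hc]; field_simp; ring
        _ ≤ ENNReal.ofReal (10 * √q) + ENNReal.ofReal (1 / D * (|S| - c)) := ENNReal.ofReal_add_le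
        _ ≤ _ := by
            refine add_le_add_right ?_ _
            rw [ENNReal.ofReal_mul (by positivity)]
            exact mul_le_mul_right hUV _
    · rw [lintegral_const_mul _ (by fun_prop), lintegral_add_left hUm]
      set E := Real.exp (-(θ * c) + (2 ^ (k + 1) : ℕ) * expBound q 1 θ) / θ with hE
      have hE0 : 0 ≤ E := by positivity
      calc _ ≤ ENNReal.ofReal (1 / D) * (ENNReal.ofReal E + ENNReal.ofReal E) := by gcongr
        _ = ENNReal.ofReal (2 * (1 / D * E)) := by
            rw [← ENNReal.ofReal_add hE0 hE0, ← ENNReal.ofReal_mul (by positivity)]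
            congr 1; ring
        _ ≤ _ := by
            refine ENNReal.ofReal_le_ofReal ?_
            calc 2 * (1 / D * E) ≤ 2 * (q ^ s * (Real.exp (-(2 * L)) + y ^ (s - 1 / 2))) := by
                  gcongr
              _ = q ^ s * (2 * Real.exp (-(2 * L)) + 2 * y ^ (s - 1 / 2)) := by ring
              _ ≤ _ := by
                  unfold blockFactor
                  have : 0 < y ^ (s - 1 / 2) := by positivity
                  rw [← hy, ← hL]
                  gcongr
                  linarith

/-- The constant in the uniform bound for normalized partial sums. -/
noncomputable def supConst (s : ℝ) : ℝ := 10 + ∑' k, blockFactor s k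

/-- A divergent `tsum` is `0`, so positivity holds without restriction on `s`. -/
lemma supConst_pos (s : ℝ) : 0 < supConst s :=
  add_pos_of_pos_of_nonneg (by norm_num) (tsum_nonneg fun k => blockFactor_nonneg s k)

/-- The uniform mean bound for normalized partial sums of variables with small variance. -/
theorem lintegral_iSup_sum_le (hg : Measurable g) (hb : ∀ x, |g x| ≤ 1) (h0 : ∫ x, g x ∂μ = 0)
    (hv : ∫ x, g x ^ 2 ∂μ ≤ q) (h1 : ∫ x, |g x| ∂μ ≤ 2 * q) (hq1 : q ≤ 1)
    (hs0 : 0 < s) (hs : s < 1 / 2) :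
    ∫⁻ ω, (⨆ n : ℕ, ⨆ _ : 1 ≤ n,
        ENNReal.ofReal (|∑ i ∈ Finset.range n, g (ω i)| / √(n * logTwo n))) ∂(iidLaw μ)
      ≤ ENNReal.ofReal (supConst s * q ^ s) := by
  have hq0 : 0 ≤ q := le_trans (integral_nonneg fun x => sq_nonneg _) hv
  choose R hRm hR hRi using fun k => exists_block_bound hg hb h0 hv h1 hq1 hs0 hs k
  have hsq : √q ≤ q ^ s := sqrt_le_rpow hq0 hq1 hs0 hs.le
  have hqs : 0 ≤ q ^ s := by positivity
  calc _ ≤ ∫⁻ ω, (ENNReal.ofReal (10 * √q) + ∑' k, R k ω) ∂(iidLaw μ) := by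
        refine lintegral_mono fun ω => iSup₂_le fun n hn => ?_
        refine (hR (Nat.log 2 n) ω n (Nat.pow_log_le_self 2 (by omega))
          (Nat.lt_pow_succ_log_self (by norm_num) n)).trans ?_
        gcongr
        exact ENNReal.le_tsum _
    _ = ENNReal.ofReal (10 * √q) + ∑' k, ∫⁻ ω, R k ω ∂(iidLaw μ) := by
        rw [lintegral_add_left measurable_const, lintegral_tsum fun k => (hRm k).aemeasurable]
        simp
    _ ≤ ENNReal.ofReal (10 * √q) + ∑' k, ENNReal.ofReal (q ^ s * blockFactor s k) := by
        gcongr with k; exact hRi k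
    _ = ENNReal.ofReal (10 * √q + q ^ s * ∑' k, blockFactor s k) := by
        rw [← ENNReal.ofReal_tsum_of_nonneg
          (fun k => mul_nonneg hqs (blockFactor_nonneg s k)) ((summable_blockFactor hs).mul_left _),
          tsum_mul_left, ENNReal.ofReal_add (by positivity)
          (mul_nonneg hqs (tsum_nonneg fun k => blockFactor_nonneg s k))]
    _ ≤ _ := by
        refine ENNReal.ofReal_le_ofReal ?_
        unfold supConst
        rw [add_mul, mul_comm (q ^ s)]
        gcongr

end UniformBound

/-! ### Dyadic shells and their grid cells -/

section Cells

variable {d : ℕ}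

/-- The index of the dyadic shell containing `x`. -/
noncomputable def shell (x : EuclideanSpace ℝ (Fin d)) : ℕ := ⌈Real.logb 2 ‖x‖⌉₊

/-- The index of the cell of level `l` containing `x`: its shell, and the grid cube of side
`2 ^ (k - l) / √d` in which it lies, where `k` is the index of the shell. -/
noncomputable def cell (l : ℕ) (x : EuclideanSpace ℝ (Fin d)) : ℕ × (Fin d → ℤ) :=
  (shell x, fun i => ⌊2 ^ l * √d / 2 ^ shell x * x i⌋)

/-- The natural ceiling truncates at `0`, so shell `0` is the whole closed unit ball; the origin
lies there by the convention `log 0 = 0`. -/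
lemma norm_le_two_pow_shell (x : EuclideanSpace ℝ (Fin d)) : ‖x‖ ≤ 2 ^ shell x := by
  rcases eq_or_ne x 0 with rfl | hx
  · simp
  · rw [← Real.rpow_natCast, ← Real.logb_le_iff_le_rpow one_lt_two (norm_pos_iff.2 hx)]
    exact Nat.le_ceil _

lemma two_pow_lt_norm_of_shell {x : EuclideanSpace ℝ (Fin d)} {k : ℕ} (h : shell x = k + 1) :
    2 ^ k < ‖x‖ := by
  have h1 : (k : ℝ) < Real.logb 2 ‖x‖ := Nat.lt_ceil.1 (by rw [shell] at h; omega)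
  have hx : 0 < ‖x‖ := by
    rw [norm_pos_iff]
    rintro rfl
    rw [norm_zero, Real.logb_zero] at h1
    exact absurd h1 (not_lt.2 (Nat.cast_nonneg k))
  rw [← Real.rpow_natCast]
  exact (Real.lt_logb_iff_rpow_lt one_lt_two hx).1 h1

lemma measurable_shell : Measurable (shell (d := d)) := by
  unfold shell
  exact Nat.measurable_ceil.comp (by unfold Real.logb; fun_prop)

lemma measurable_cell (l : ℕ) : Measurable (cell (d := d) l) := by
  refine measurable_shell.prodMk (measurable_pi_lambda _ fun i => Int.measurable_floor.comp ?_)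
  have h : Measurable fun x : EuclideanSpace ℝ (Fin d) => 2 ^ l * √d / (2 : ℝ) ^ shell x :=
    (measurable_from_nat (f := fun k : ℕ => 2 ^ l * √d / (2 : ℝ) ^ k)).comp measurable_shell
  exact h.mul (by fun_prop)

lemma floor_eq_of_floor_two_mul_eq {a b : ℝ} (h : ⌊2 * a⌋ = ⌊2 * b⌋) : ⌊a⌋ = ⌊b⌋ := by
  have key : ∀ c : ℝ, ⌊c⌋ = ⌊2 * c⌋ / 2 := by
    intro c
    have h1 := Int.floor_le c
    have h2 := Int.lt_floor_add_one c
    have h3 : 2 * ⌊c⌋ ≤ ⌊2 * c⌋ := Int.le_floor.2 (by push_cast; linarith)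
    have h4 : ⌊2 * c⌋ < 2 * ⌊c⌋ + 2 := Int.floor_lt.2 (by push_cast; linarith)
    omega
  rw [key a, key b, h]

lemma cell_eq_of_cell_succ_eq (l : ℕ) (x y : EuclideanSpace ℝ (Fin d))
    (h : cell (l + 1) x = cell (l + 1) y) : cell l x = cell l y := by
  simp only [cell, Prod.mk.injEq] at h ⊢
  refine ⟨h.1, funext fun i => floor_eq_of_floor_two_mul_eq ?_⟩
  have := congrFun h.2 i
  simp only [pow_succ] at this
  convert this using 2 <;> ring_nf

/-- Coordinates differ by at most the side `2^(k-l) / √d`, and the `√d` cancels in the Euclidean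
norm. Dimension zero is separate because of this division. -/
lemma norm_sub_le_of_cell_eq (l : ℕ) (x y : EuclideanSpace ℝ (Fin d)) (h : cell l x = cell l y) :
    ‖x - y‖ ≤ 2 ^ shell x / 2 ^ l := by
  simp only [cell, Prod.mk.injEq] at h
  obtain ⟨h1, h2⟩ := h
  rcases d.eq_zero_or_pos with rfl | hd
  · have : x = y := Subsingleton.elim _ _
    rw [this, sub_self, norm_zero]; positivity
  have hd0 : (0 : ℝ) < d := by exact_mod_cast hd
  set a : ℝ := 2 ^ shell x / 2 ^ l with ha
  have ha0 : 0 < a := by positivity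
  have hc : ∀ i, |(x - y) i| ≤ a / √d := by
    intro i
    have h3 := congrFun h2 i
    rw [← h1] at h3
    have h4 := Int.abs_sub_lt_one_of_floor_eq_floor h3
    rw [← mul_sub, abs_mul, abs_of_nonneg (by positivity)] at h4
    rw [PiLp.sub_apply, le_div_iff₀ (by positivity)]
    have h5 : 2 ^ l * √d / 2 ^ shell x * |x i - y i| * a = |x i - y i| * √d := by
      rw [ha]; field_simp
    rw [← h5]
    exact mul_le_of_le_one_left ha0.le h4.le
  rw [EuclideanSpace.norm_eq]
  refine Real.sqrt_le_iff.2 ⟨ha0.le, ?_⟩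
  calc ∑ i, ‖(x - y) i‖ ^ 2 ≤ ∑ i : Fin d, (a / √d) ^ 2 :=
        Finset.sum_le_sum fun i _ => pow_le_pow_left₀ (norm_nonneg _) (hc i) 2
    _ = a ^ 2 := by
        rw [Finset.sum_const, Finset.card_univ, Fintype.card_fin, nsmul_eq_mul, div_pow,
          Real.sq_sqrt hd0.le]
        field_simp

/-- Cauchy–Schwarz gives `∑ |x i| ≤ √d * ‖x‖`. Constraining the sum, not each coordinate, keeps the
number of cells exponential in `d`; coordinatewise bounds would bring in `d^(d/2)`. -/
lemma sum_abs_cell_le (l : ℕ) (x : EuclideanSpace ℝ (Fin d)) :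
    ∑ i, |(cell l x).2 i| ≤ 2 * d * 2 ^ l := by
  rcases d.eq_zero_or_pos with rfl | hd
  · simp
  have hd0 : (0 : ℝ) < d := by exact_mod_cast hd
  have habs : ∀ t : ℝ, |((⌊t⌋ : ℤ) : ℝ)| ≤ |t| + 1 := by
    intro t
    have h1 := Int.floor_le t
    have h2 := Int.lt_floor_add_one t
    refine abs_le.2 ⟨?_, ?_⟩
    · have := neg_abs_le t; linarith
    · have := le_abs_self t; linarith
  have h1 : ∑ i, |x i| ≤ √d * ‖x‖ := by
    have h := Finset.sum_mul_sq_le_sq_mul_sq Finset.univ (fun _ : Fin d => (1 : ℝ)) fun i => |x i|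
    simp only [one_mul, one_pow, Finset.sum_const, Finset.card_univ, Fintype.card_fin,
      nsmul_eq_mul, mul_one, sq_abs] at h
    refine (pow_le_pow_iff_left₀ (Finset.sum_nonneg fun _ _ => abs_nonneg _) (by positivity)
      two_ne_zero).1 ?_
    rw [mul_pow, Real.sq_sqrt hd0.le, EuclideanSpace.norm_sq_eq]
    simpa using h
  have h2 : ((∑ i, |(cell l x).2 i| : ℤ) : ℝ) ≤ ((2 * d * 2 ^ l : ℤ) : ℝ) := by
    push_cast
    set a : ℝ := 2 ^ l * √d / 2 ^ shell x with ha
    have ha0 : 0 ≤ a := by positivity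
    calc ∑ i, |(((cell l x).2 i : ℤ) : ℝ)| ≤ ∑ i, (a * |x i| + 1) := by
          refine Finset.sum_le_sum fun i _ => (habs _).trans ?_
          rw [abs_mul, abs_of_nonneg ha0]
      _ = a * ∑ i, |x i| + d := by
          rw [Finset.sum_add_distrib, ← Finset.mul_sum]; simp
      _ ≤ a * (√d * 2 ^ shell x) + d := by
          have := norm_le_two_pow_shell x
          gcongr
          exact h1.trans (by gcongr)
      _ = 2 ^ l * d + d := by
          rw [ha, show 2 ^ l * √d / 2 ^ shell x * (√d * 2 ^ shell x) = 2 ^ l * (√d * √d) by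
            field_simp, Real.mul_self_sqrt hd0.le]
      _ ≤ 2 * d * 2 ^ l := by
          have : (1 : ℝ) ≤ 2 ^ l := one_le_pow₀ one_le_two
          nlinarith
  exact_mod_cast h2

/-- The positions of cells of level `l` inside a shell. -/
noncomputable def positions (d l : ℕ) : Finset (Fin d → ℤ) :=
  (Fintype.piFinset fun _ => Finset.Icc (-(2 * d * 2 ^ l : ℤ)) (2 * d * 2 ^ l)).filter
    fun z => ∑ i, |z i| ≤ 2 * d * 2 ^ l

lemma cell_mem_positions (l : ℕ) (x : EuclideanSpace ℝ (Fin d)) :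
    (cell l x).2 ∈ positions d l := by
  have h := sum_abs_cell_le l x
  refine Finset.mem_filter.2 ⟨Fintype.mem_piFinset.2 fun i => ?_, h⟩
  rw [Finset.mem_Icc, ← abs_le]
  exact (Finset.single_le_sum (f := fun i => |(cell l x).2 i|) (fun _ _ => abs_nonneg _)
    (Finset.mem_univ i)).trans h

lemma hasSum_pow_natAbs {u : ℝ} (hu0 : 0 ≤ u) (hu1 : u < 1) :
    HasSum (fun z : ℤ => u ^ z.natAbs) ((1 - u)⁻¹ + u * (1 - u)⁻¹) := by
  have h := hasSum_geometric_of_lt_one hu0 hu1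
  refine HasSum.of_nat_of_neg_add_one (f := fun z : ℤ => u ^ z.natAbs) (by simpa using h) ?_
  have e : (fun n : ℕ => u ^ (-((n : ℤ) + 1)).natAbs) = fun n => u * u ^ n := by
    ext n
    rw [← pow_succ', show (-((n : ℤ) + 1)).natAbs = n + 1 by omega]
  change HasSum (fun n : ℕ => u ^ (-((n : ℤ) + 1)).natAbs) _
  rw [e]
  exact h.mul_left u

/-- The number of cells of level `l` inside a shell. -/
lemma card_positions_le (d l : ℕ) : ((positions d l).card : ℝ) ≤ (32 * 2 ^ l) ^ d := by
  set t : ℝ := 1 / 2 ^ l with ht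
  have ht0 : 0 < t := by positivity
  have ht1 : t ≤ 1 := by
    rw [ht, div_le_one (by positivity)]; exact one_le_pow₀ one_le_two
  -- Exponential weighting: each admissible `z` has weight `u^(∑ |z i|) ≥ e^(-2d)`, while the total
  -- weight factorizes into `d` geometric sums of at most `4 * 2^l`. As `e^2 < 8`, the constant is
  -- `8 * 4 = 32`.
  set u := Real.exp (-t) with hu
  have hu0 : 0 < u := Real.exp_pos _
  have hu1 : u < 1 := by rw [hu, ← Real.exp_zero]; exact Real.exp_lt_exp.2 (by linarith)
  have hu2 : t / 2 ≤ 1 - u := by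
    have h1 : 1 + t ≤ Real.exp t := by linarith [Real.add_one_le_exp t]
    have h2 : u * Real.exp t = 1 := by rw [hu, ← Real.exp_add]; simp
    nlinarith
  have hone : ∀ M : ℤ, ∑ z ∈ Finset.Icc (-M) M, u ^ z.natAbs ≤ 4 * 2 ^ l := by
    intro M
    refine (sum_le_hasSum _ (fun z _ => by positivity) (hasSum_pow_natAbs hu0.le hu1)).trans ?_
    have h3 : (1 - u)⁻¹ ≤ 2 * 2 ^ l := by
      rw [inv_le_comm₀ (by linarith) (by positivity)]
      refine le_trans (le_of_eq ?_) hu2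
      rw [ht]; field_simp
    have h4 : u * (1 - u)⁻¹ ≤ (1 - u)⁻¹ := by
      have : 0 < (1 - u)⁻¹ := by rw [inv_pos]; linarith
      nlinarith
    linarith
  have hmem : ∀ z ∈ positions d l, 1 ≤ Real.exp (2 * d) * ∏ i, u ^ (z i).natAbs := by
    intro z hz
    have hz2 := (Finset.mem_filter.1 hz).2
    have h5 : ((∑ i, |z i| : ℤ) : ℝ) ≤ ((2 * d * 2 ^ l : ℤ) : ℝ) := by exact_mod_cast hz2
    have h6 : ∏ i, u ^ (z i).natAbs = Real.exp (-(t * ((∑ i, |z i| : ℤ) : ℝ))) := by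
      rw [hu, Finset.prod_congr rfl fun i _ => (Real.exp_nat_mul (-t) (z i).natAbs).symm,
        ← Real.exp_sum]
      congr 1
      push_cast
      rw [Finset.mul_sum, ← Finset.sum_neg_distrib]
      refine Finset.sum_congr rfl fun i _ => ?_
      rw [Nat.cast_natAbs]; push_cast; ring
    rw [h6, ← Real.exp_add, ← Real.exp_zero, Real.exp_le_exp]
    have h7 : t * ((∑ i, |z i| : ℤ) : ℝ) ≤ t * (2 * d * 2 ^ l) := by
      gcongr; push_cast at h5 ⊢; exact h5
    have h8 : t * (2 * d * 2 ^ l) = 2 * d := by rw [ht]; field_simp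
    linarith
  calc ((positions d l).card : ℝ) = ∑ z ∈ positions d l, 1 := by simp
    _ ≤ ∑ z ∈ positions d l, Real.exp (2 * d) * ∏ i, u ^ (z i).natAbs := Finset.sum_le_sum hmem
    _ ≤ ∑ z ∈ Fintype.piFinset fun _ : Fin d =>
          Finset.Icc (-(2 * d * 2 ^ l : ℤ)) (2 * d * 2 ^ l),
          Real.exp (2 * d) * ∏ i, u ^ (z i).natAbs :=
        Finset.sum_le_sum_of_subset_of_nonneg (Finset.filter_subset _ _)
          fun _ _ _ => by positivity
    _ = Real.exp (2 * d) *
          (∑ z ∈ Finset.Icc (-(2 * d * 2 ^ l : ℤ)) (2 * d * 2 ^ l), u ^ z.natAbs) ^ d := by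
        rw [← Finset.mul_sum, Finset.sum_prod_piFinset _ fun _ (z : ℤ) => u ^ z.natAbs]
        simp
    _ ≤ 8 ^ d * (4 * 2 ^ l) ^ d := by
        have h9 : Real.exp (2 * d) ≤ 8 ^ d := by
          rw [mul_comm, Real.exp_nat_mul]
          gcongr
          rw [show (2 : ℝ) = 1 + 1 by norm_num, Real.exp_add]
          have := Real.exp_one_lt_d9
          have := Real.exp_pos 1
          nlinarith
        gcongr
        exact hone _
    _ = _ := by rw [← mul_pow]; congr 1; ring

/-- Concavity: the sum of the `s`-th powers of the masses of the cells inside a shell. -/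
lemma tsum_cell_rpow_le (μ : Measure (EuclideanSpace ℝ (Fin d))) {s : ℝ} (hs0 : 0 < s)
    (hs1 : s ≤ 1) (l k : ℕ) :
    ∑' z, μ (cell l ⁻¹' {(k, z)}) ^ s ≤
      ENNReal.ofReal (((32 * 2 ^ l : ℝ) ^ d) ^ (1 - s)) * μ (shell ⁻¹' {k}) ^ s := by
  set T := positions d l
  have hzero : ∀ z ∉ T, μ (cell l ⁻¹' {(k, z)}) ^ s = 0 := by
    intro z hz
    have : cell (d := d) l ⁻¹' {(k, z)} = ∅ := by
      ext x
      simp only [Set.mem_preimage, Set.mem_singleton_iff, Set.mem_empty_iff_false, iff_false]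
      intro h
      exact hz (by have := cell_mem_positions l x; rwa [h] at this)
    rw [this, measure_empty, ENNReal.zero_rpow_of_pos hs0]
  rw [tsum_eq_sum hzero]
  have hsum : ∑ z ∈ T, μ (cell l ⁻¹' {(k, z)}) ≤ μ (shell ⁻¹' {k}) := by
    rw [← measure_biUnion_finset]
    · refine measure_mono fun x hx => ?_
      simp only [Set.mem_iUnion, Set.mem_preimage, Set.mem_singleton_iff] at hx ⊢
      obtain ⟨z, -, h⟩ := hx
      exact congrArg Prod.fst h
    · intro z _ z' _ hzz
      rw [Function.onFun, Set.disjoint_left]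
      intro x hx hx'
      simp only [Set.mem_preimage, Set.mem_singleton_iff] at hx hx'
      exact hzz (congrArg Prod.snd (hx.symm.trans hx'))
    · exact fun z _ => measurable_cell l (measurableSet_singleton _)
  -- The power mean inequality of exponent `1 / s`, applied to the `s`-th powers.
  have hp : 1 ≤ 1 / s := (one_le_div hs0).2 hs1
  have h := ENNReal.rpow_sum_le_const_mul_sum_rpow T (fun z => μ (cell l ⁻¹' {(k, z)}) ^ s) hp
  simp only [← ENNReal.rpow_mul, mul_one_div_cancel hs0.ne', ENNReal.rpow_one] at h
  have h2 := ENNReal.rpow_le_rpow h hs0.le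
  rw [← ENNReal.rpow_mul, one_div_mul_cancel hs0.ne', ENNReal.rpow_one,
    ENNReal.mul_rpow_of_nonneg _ _ hs0.le, ← ENNReal.rpow_mul,
    show (1 / s - 1) * s = 1 - s by field_simp] at h2
  refine h2.trans ?_
  have h3 : (T.card : ℝ≥0∞) ^ (1 - s) ≤ ENNReal.ofReal (((32 * 2 ^ l : ℝ) ^ d) ^ (1 - s)) := by
    rw [← ENNReal.ofReal_rpow_of_nonneg (by positivity) (by linarith)]
    refine ENNReal.rpow_le_rpow ?_ (by linarith)
    rw [← ENNReal.ofReal_natCast]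
    exact ENNReal.ofReal_le_ofReal (card_positions_le d l)
  gcongr

/-- The shells outside the unit ball have small mass. -/
lemma measure_shell_succ_le (μ : Measure (EuclideanSpace ℝ (Fin d))) {β : ℝ} (hβ : 0 < β)
    (hμ : Integrable (fun x => ‖x‖ ^ β) μ) (k : ℕ) :
    μ (shell ⁻¹' {k + 1}) ≤ ENNReal.ofReal (absMoment β μ / (2 ^ k) ^ β) := by
  have hpos : (0 : ℝ) < (2 ^ k) ^ β := by positivity
  have hsub : shell (d := d) ⁻¹' {k + 1} ⊆
      {x | ENNReal.ofReal ((2 ^ k) ^ β) ≤ ENNReal.ofReal (‖x‖ ^ β)} := by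
    intro x hx
    refine ENNReal.ofReal_le_ofReal (Real.rpow_le_rpow (by positivity) ?_ hβ.le)
    exact (two_pow_lt_norm_of_shell hx).le
  refine (measure_mono hsub).trans ?_
  refine (meas_ge_le_lintegral_div (by fun_prop) (by simpa using hpos) (by simp)).trans
    (le_of_eq ?_)
  rw [← ofReal_integral_eq_lintegral_ofReal hμ (ae_of_all _ fun x => by positivity),
    ← ENNReal.ofReal_div_of_pos hpos]
  rfl

lemma absMoment_nonneg (β : ℝ) (μ : Measure (EuclideanSpace ℝ (Fin d))) : 0 ≤ absMoment β μ :=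
  integral_nonneg fun _ => by positivity

/-- The weighted sum over the shells of the `s`-th powers of their masses. -/
lemma tsum_shell_rpow_le (μ : Measure (EuclideanSpace ℝ (Fin d))) [IsProbabilityMeasure μ]
    {p β s : ℝ} (hβ : 0 < β) (hμ : Integrable (fun x => ‖x‖ ^ β) μ) (hs0 : 0 < s)
    (hσ : 0 < β * s - p) :
    ∑' k : ℕ, ENNReal.ofReal (((2 : ℝ) ^ k) ^ p) * μ (shell ⁻¹' {k}) ^ s ≤
      ENNReal.ofReal (1 + 2 ^ p / (1 - 2 ^ (-(β * s - p))) * absMoment β μ ^ s) := by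
  set m := absMoment β μ
  have hm : 0 ≤ m := absMoment_nonneg β μ
  set u : ℝ := 2 ^ (-(β * s - p)) with hu
  have hu0 : 0 < u := by positivity
  have hu1 : u < 1 := Real.rpow_lt_one_of_one_lt_of_neg one_lt_two (by linarith)
  have hterm : ∀ k : ℕ, ENNReal.ofReal (((2 : ℝ) ^ (k + 1)) ^ p) * μ (shell ⁻¹' {k + 1}) ^ s
      ≤ ENNReal.ofReal (2 ^ p * m ^ s * u ^ k) := by
    intro k
    have h1 := ENNReal.rpow_le_rpow (measure_shell_succ_le μ hβ hμ k) hs0.le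
    rw [ENNReal.ofReal_rpow_of_nonneg (by positivity) hs0.le] at h1
    calc _ ≤ ENNReal.ofReal (((2 : ℝ) ^ (k + 1)) ^ p) *
          ENNReal.ofReal ((m / (2 ^ k) ^ β) ^ s) := by gcongr
      _ = ENNReal.ofReal (((2 : ℝ) ^ (k + 1)) ^ p * (m / (2 ^ k) ^ β) ^ s) := by
          rw [ENNReal.ofReal_mul (by positivity)]
      _ = _ := by
          congr 1
          rw [pow_succ, Real.mul_rpow (by positivity) (by norm_num),
            Real.div_rpow hm (by positivity), hu, ← Real.rpow_natCast, ← Real.rpow_natCast,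
            ← Real.rpow_mul (by norm_num), ← Real.rpow_mul (by norm_num),
            ← Real.rpow_mul (by norm_num), ← Real.rpow_mul (by norm_num), div_eq_mul_inv,
            ← Real.rpow_neg (by norm_num)]
          rw [show -(β * s - p) * k = k * p + -(k * β * s) by ring, Real.rpow_add (by norm_num)]
          ring_nf
  -- Shell `0` contributes the `1`. Shell `k + 1` has weight `2^((k+1)p)` but lies outside the ball
  -- of radius `2^k`; this shift is the source of the factor `2^p`.
  rw [tsum_eq_zero_add' ENNReal.summable]
  have hgeo : ∑' k : ℕ, ENNReal.ofReal (2 ^ p * m ^ s * u ^ k)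
      = ENNReal.ofReal (2 ^ p / (1 - u) * m ^ s) := by
    rw [← ENNReal.ofReal_tsum_of_nonneg (fun k => by positivity)
      ((summable_geometric_of_lt_one hu0.le hu1).mul_left _), tsum_mul_left,
      tsum_geometric_of_lt_one hu0.le hu1]
    congr 1; ring
  have hnn : 0 ≤ 2 ^ p / (1 - u) * m ^ s :=
    mul_nonneg (div_nonneg (by positivity) (by linarith)) (by positivity)
  rw [ENNReal.ofReal_add zero_le_one hnn, ← hgeo]
  refine add_le_add ?_ (ENNReal.tsum_le_tsum hterm)
  simp only [pow_zero, Real.one_rpow, ENNReal.ofReal_one, one_mul]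
  exact ENNReal.rpow_le_one prob_le_one hs0.le

end Cells

/-! ### Transport cost bounded by cell discrepancies -/

section Deterministic

open Topology

variable {d : ℕ} {p : ℝ}

/-- The `p`-th power of the bound `2 ^ (k - l)` for the diameter of a cell of level `l` in the
shell `k`. -/
noncomputable def levelWeight (p : ℝ) (l : ℕ) (i : ℕ × (Fin d → ℤ)) : ℝ≥0∞ :=
  ENNReal.ofReal (((2 : ℝ) ^ i.1 / 2 ^ l) ^ p)

lemma levelWeight_eq (l : ℕ) (i : ℕ × (Fin d → ℤ)) :
    levelWeight p l i = ENNReal.ofReal (((2 : ℝ) ^ l) ^ (-p)) * levelWeight p 0 i := by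
  unfold levelWeight
  rw [← ENNReal.ofReal_mul (by positivity)]
  congr 1
  rw [pow_zero, div_one, Real.div_rpow (by positivity) (by positivity), Real.rpow_neg (by positivity)]
  ring

lemma edist_rpow_le_levelWeight (hp : 0 ≤ p) (l : ℕ) (x y : EuclideanSpace ℝ (Fin d))
    (h : cell l x = cell l y) : edist x y ^ p ≤ levelWeight p l (cell l x) := by
  rw [edist_dist, dist_eq_norm, ENNReal.ofReal_rpow_of_nonneg (norm_nonneg _) hp]
  exact ENNReal.ofReal_le_ofReal
    (Real.rpow_le_rpow (norm_nonneg _) (norm_sub_le_of_cell_eq l x y h) hp)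

lemma enorm_rpow_le_levelWeight (hp : 0 ≤ p) (l : ℕ) (x : EuclideanSpace ℝ (Fin d)) :
    ‖x‖ₑ ^ p ≤ levelWeight p 0 (cell l x) := by
  rw [← ofReal_norm, ENNReal.ofReal_rpow_of_nonneg (norm_nonneg _) hp]
  refine ENNReal.ofReal_le_ofReal (Real.rpow_le_rpow (norm_nonneg _) ?_ hp)
  rw [pow_zero, div_one]
  exact norm_le_two_pow_shell x

/-- The transport cost is controlled by the differences of the masses of the cells. -/
theorem wassersteinDist_rpow_le (hp : 1 ≤ p) (μ ν : Measure (EuclideanSpace ℝ (Fin d)))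
    [IsProbabilityMeasure μ] [IsProbabilityMeasure ν]
    (hμ : ∫⁻ x, levelWeight p 0 (cell 0 x) ∂μ ≠ ∞) (l : ℕ) :
    wassersteinDist p μ ν ^ p ≤
      2 ^ (p - 1) * ∑' i, levelWeight p 0 i * massDiff μ ν (cell l ⁻¹' {i}) +
        ∑' t : ℕ, ∑' i, levelWeight p (l + t) i * massDiff μ ν (cell (l + t + 1) ⁻¹' {i}) := by
  have hp0 : 0 < p := by linarith
  have hlim : Tendsto (fun j : ℕ => ∫⁻ x, levelWeight p (l + j) (cell (l + j) x) ∂μ) atTop (𝓝 0) := by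
    have h1 : Tendsto (fun j : ℕ => ENNReal.ofReal (((2 : ℝ) ^ (l + j)) ^ (-p)) *
        ∫⁻ x, levelWeight p 0 (cell 0 x) ∂μ) atTop (𝓝 0) := by
      rw [← zero_mul (∫⁻ x, levelWeight p 0 (cell 0 x) ∂μ)]
      refine ENNReal.Tendsto.mul_const ?_ (Or.inr hμ)
      rw [← ENNReal.ofReal_zero]
      refine ENNReal.tendsto_ofReal ?_
      refine (tendsto_rpow_neg_atTop hp0).comp ?_
      exact (tendsto_pow_atTop_atTop_of_one_lt one_lt_two).comp
        (tendsto_add_atTop_nat l |>.congr fun j => by rw [add_comm])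
    refine h1.congr fun j => ?_
    rw [← lintegral_const_mul' _ _ ENNReal.ofReal_ne_top]
    refine lintegral_congr fun x => ?_
    rw [levelWeight_eq (l + j)]
    rfl
  -- The bound holds for every depth `j`. Letting `j` grow removes the last term, without any limit
  -- of couplings.
  refine ge_of_tendsto' (by simpa using tendsto_const_nhds.add hlim :
    Tendsto _ atTop (𝓝 (2 ^ (p - 1) * ∑' i, levelWeight p 0 i * massDiff μ ν (cell l ⁻¹' {i}) +
        ∑' t : ℕ, ∑' i, levelWeight p (l + t) i * massDiff μ ν (cell (l + t + 1) ⁻¹' {i}))))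
    fun j => ?_
  obtain ⟨γ, hγ, hle⟩ := exists_coupling_of_levels (Q := cell (d := d)) measurable_cell
    cell_eq_of_cell_succ_eq (c := fun z => edist z.1 z.2 ^ p) (w := levelWeight p)
    (r := fun i => 2 ^ (p - 1) * levelWeight p 0 i)
    (edist_rpow_le_levelWeight hp0.le) (fun _ _ => rfl) l j
    (fun x y => by
      rw [← mul_add]
      refine (edist_rpow_le hp x y).trans ?_
      gcongr <;> exact enorm_rpow_le_levelWeight hp0.le l _) μ ν
  have h1 : wassersteinDist p μ ν ≤ (∫⁻ z, edist z.1 z.2 ^ p ∂γ) ^ (1 / p) :=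
    iInf_le (fun γ : {γ : Measure (EuclideanSpace ℝ (Fin d) × EuclideanSpace ℝ (Fin d)) //
      γ.map Prod.fst = μ ∧ γ.map Prod.snd = ν} => (∫⁻ z, edist z.1 z.2 ^ p ∂γ.1) ^ (1 / p)) ⟨γ, hγ⟩
  have h2 := ENNReal.rpow_le_rpow h1 hp0.le
  rw [← ENNReal.rpow_mul, one_div_mul_cancel hp0.ne', ENNReal.rpow_one] at h2
  refine h2.trans (hle.trans ?_)
  gcongr
  · rw [← ENNReal.tsum_mul_left]
    simp_rw [mul_assoc]; exact le_rfl
  · exact ENNReal.sum_le_tsum _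

end Deterministic

/-! ### Normalized deviations of empirical frequencies -/

section Deviation

variable {X : Type*} [MeasurableSpace X] {μ : Measure X} {A : Set X}

/-- The normalized deviation of the empirical frequency of `A`. -/
noncomputable def deviation (μ : Measure X) (A : Set X) (n : ℕ) (ω : ℕ → X) : ℝ≥0∞ :=
  ENNReal.ofReal √(n / logTwo n) * massDiff μ (empiricalMeasure n ω) A

/-- The supremum over the sample size of the normalized deviation. -/
noncomputable def supDeviation (μ : Measure X) (A : Set X) (ω : ℕ → X) : ℝ≥0∞ :=
  ⨆ n : ℕ, ⨆ _ : 1 ≤ n, deviation μ A n ω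

lemma deviation_le_supDeviation {n : ℕ} (hn : 1 ≤ n) (ω : ℕ → X) :
    deviation μ A n ω ≤ supDeviation μ A ω := le_iSup₂ (f := fun n _ => deviation μ A n ω) n hn

/-- The centred indicator of `A`. -/
noncomputable def centredIndicator (μ : Measure X) (A : Set X) (x : X) : ℝ :=
  A.indicator (fun _ => (1 : ℝ)) x - μ.real A

lemma measurable_centredIndicator (hA : MeasurableSet A) : Measurable (centredIndicator μ A) :=
  (measurable_const.indicator hA).sub measurable_const

variable [IsProbabilityMeasure μ]

lemma abs_centredIndicator_le (x : X) : |centredIndicator μ A x| ≤ 1 := by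
  have h0 : 0 ≤ μ.real A := measureReal_nonneg
  have h1 : μ.real A ≤ 1 := measureReal_le_one
  unfold centredIndicator
  by_cases hx : x ∈ A <;> simp only [hx, Set.indicator_of_mem, Set.indicator_of_notMem,
    not_false_eq_true] <;> rw [abs_le] <;> constructor <;> linarith

lemma integrable_indicator_one (hA : MeasurableSet A) :
    Integrable (A.indicator fun _ => (1 : ℝ)) μ := (integrable_const 1).indicator hA

lemma integral_centredIndicator (hA : MeasurableSet A) : ∫ x, centredIndicator μ A x ∂μ = 0 := by
  unfold centredIndicator
  rw [integral_sub (integrable_indicator_one hA) (integrable_const _), integral_indicator_const _ hA]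
  simp

lemma integral_sub_const_sq_le {f : X → ℝ} (hf : Integrable f μ)
    (hf2 : Integrable (fun x => f x ^ 2) μ) :
    ∫ x, (f x - ∫ y, f y ∂μ) ^ 2 ∂μ ≤ ∫ x, f x ^ 2 ∂μ := by
  set c := ∫ y, f y ∂μ
  have : ∫ x, (f x - c) ^ 2 ∂μ = ∫ x, f x ^ 2 ∂μ - c ^ 2 := by
    have e : ∀ x, (f x - c) ^ 2 = f x ^ 2 - (2 * c) * f x + c ^ 2 := fun x => by ring
    simp_rw [e]
    have h1 : Integrable (fun x => (2 * c) * f x) μ := hf.const_mul _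
    have h2 : Integrable (fun x => f x ^ 2 - (2 * c) * f x) μ := hf2.sub h1
    rw [integral_add h2 (integrable_const _), integral_sub hf2 h1, integral_const_mul]
    simp only [integral_const, probReal_univ, smul_eq_mul, one_mul]
    change _ - 2 * c * c + c ^ 2 = _
    ring
  rw [this]
  linarith [sq_nonneg c]

lemma integral_centredIndicator_sq_le (hA : MeasurableSet A) :
    ∫ x, centredIndicator μ A x ^ 2 ∂μ ≤ μ.real A := by
  have e : (fun x => (A.indicator (fun _ => (1 : ℝ)) x) ^ 2) = A.indicator fun _ => (1 : ℝ) := by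
    ext x; by_cases hx : x ∈ A <;> simp [hx]
  have h := integral_sub_const_sq_le (μ := μ) (integrable_indicator_one hA)
    (by rw [e]; exact integrable_indicator_one hA)
  rw [e, integral_indicator_const _ hA] at h
  simpa [centredIndicator] using h

lemma integral_abs_centredIndicator_le (hA : MeasurableSet A) :
    ∫ x, |centredIndicator μ A x| ∂μ ≤ 2 * μ.real A := by
  have h0 : 0 ≤ μ.real A := measureReal_nonneg
  calc ∫ x, |centredIndicator μ A x| ∂μ ≤ ∫ x, (A.indicator (fun _ => (1 : ℝ)) x + μ.real A) ∂μ := by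
        refine integral_mono ?_ ((integrable_indicator_one hA).add (integrable_const _)) fun x => ?_
        · exact ((integrable_indicator_one hA).sub (integrable_const _)).abs
        · refine (abs_sub _ _).trans ?_
          rw [abs_of_nonneg h0, abs_of_nonneg (Set.indicator_nonneg (fun _ _ => zero_le_one) x)]
    _ = 2 * μ.real A := by
        rw [integral_add (integrable_indicator_one hA) (integrable_const _),
          integral_indicator_const _ hA]
        simp only [smul_eq_mul, mul_one, integral_const, probReal_univ, one_mul]
        ring

/-- Because `√(n / L) / n = 1 / √(n L)`, frequencies become normalized partial sums of the centred
indicator. -/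
lemma deviation_eq (hA : MeasurableSet A) {n : ℕ} (hn : 1 ≤ n) (ω : ℕ → X) :
    deviation μ A n ω
      = ENNReal.ofReal (|∑ i ∈ Finset.range n, centredIndicator μ A (ω i)| / √(n * logTwo n)) := by
  have hn0 : (0 : ℝ) < n := by exact_mod_cast hn
  have hL := logTwo_pos n
  set N := ∑ i ∈ Finset.range n, A.indicator (fun _ => (1 : ℝ)) (ω i) with hN
  have hN0 : 0 ≤ N := Finset.sum_nonneg fun i _ => Set.indicator_nonneg (fun _ _ => zero_le_one) _
  have h1 : empiricalMeasure n ω A = ENNReal.ofReal (N / n) := by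
    rw [empiricalMeasure_apply n ω hA, ENNReal.ofReal_div_of_pos hn0, ENNReal.div_eq_inv_mul,
      ENNReal.ofReal_natCast, hN, ENNReal.ofReal_sum_of_nonneg
      fun i _ => Set.indicator_nonneg (fun _ _ => zero_le_one) _]
    congr 1
    refine Finset.sum_congr rfl fun i _ => ?_
    by_cases hx : ω i ∈ A <;> simp [hx]
  have h2 : massDiff μ (empiricalMeasure n ω) A = ENNReal.ofReal |N / n - μ.real A| := by
    rw [massDiff, h1, ← ofReal_measureReal (μ := μ) (s := A),
      ← ENNReal.ofReal_sub _ (by positivity), ← ENNReal.ofReal_sub _ measureReal_nonneg]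
    rcases le_total (N / n) (μ.real A) with h | h
    · rw [ENNReal.ofReal_of_nonpos (p := N / n - μ.real A) (by linarith), add_zero,
        abs_of_nonpos (by linarith), neg_sub]
    · rw [ENNReal.ofReal_of_nonpos (p := μ.real A - N / n) (by linarith), zero_add,
        abs_of_nonneg (by linarith)]
  have h3 : ∑ i ∈ Finset.range n, centredIndicator μ A (ω i) = n * (N / n - μ.real A) := by
    unfold centredIndicator
    rw [Finset.sum_sub_distrib, ← hN]
    simp; field_simp
  rw [deviation, h2, h3, ← ENNReal.ofReal_mul (Real.sqrt_nonneg _), abs_mul, abs_of_pos hn0]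
  congr 1
  rw [Real.sqrt_div hn0.le, Real.sqrt_mul hn0.le]
  have h4 : (n : ℝ) = √n * √n := (Real.mul_self_sqrt hn0.le).symm
  have h5 : 0 < √(n : ℝ) := by positivity
  have h6 : 0 < √(logTwo n) := by positivity
  rw [div_mul_eq_mul_div, div_eq_div_iff h6.ne' (by positivity)]
  linear_combination (-(|N / n - μ.real A| * √(logTwo n))) * h4

lemma measurable_supDeviation (hA : MeasurableSet A) : Measurable (supDeviation μ A) := by
  refine Measurable.iSup fun n => Measurable.iSup fun hn => ?_
  have h := measurable_centredIndicator (μ := μ) hA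
  simp_rw [show (fun ω => deviation μ A n ω) = _ from funext fun ω => deviation_eq hA hn ω]
  fun_prop

/-- The centred indicator has variance at most `μ A` and mean absolute value at most `2 μ A`, so the
uniform bound applies with `q = μ A`. -/
lemma lintegral_supDeviation_le (hA : MeasurableSet A) {s : ℝ} (hs0 : 0 < s) (hs : s < 1 / 2) :
    ∫⁻ ω, supDeviation μ A ω ∂(iidLaw μ) ≤ ENNReal.ofReal (supConst s) * μ A ^ s := by
  have h := lintegral_iSup_sum_le (measurable_centredIndicator (μ := μ) hA)
    abs_centredIndicator_le (integral_centredIndicator hA) (integral_centredIndicator_sq_le hA)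
    (integral_abs_centredIndicator_le hA) measureReal_le_one hs0 hs
  rw [ENNReal.ofReal_mul (supConst_pos s).le, ← ENNReal.ofReal_rpow_of_nonneg measureReal_nonneg
    hs0.le, ofReal_measureReal] at h
  refine le_trans (le_of_eq ?_) h
  refine lintegral_congr fun ω => ?_
  refine iSup_congr fun n => iSup_congr fun hn => deviation_eq hA hn ω

end Deviation

/-! ### Iterated logarithm for finite sums of absolute deviations -/

section SignedSums

variable {X ι : Type*} [MeasurableSpace X] {μ : Measure X} [IsProbabilityMeasure μ] [Countable ι]
  [MeasurableSpace ι] [MeasurableSingletonClass ι] {Q : X → ι} {w : ι → ℝ} {V κ : ℝ}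

/-- The law of the iterated logarithm for a signed combination of frequencies. -/
lemma ae_eventually_signed_sum_le (hQ : Measurable Q) (hV0 : 0 < V)
    (hint : Integrable (fun x => w (Q x) ^ 2) μ) (hV : ∫ x, w (Q x) ^ 2 ∂μ ≤ V) (hκ : 1 < κ)
    (F : Finset ι) (σ : ι → ℝ) (hσ : ∀ i, |σ i| ≤ 1) :
    ∀ᵐ ω ∂(iidLaw μ), ∀ᶠ n : ℕ in atTop,
      ∑ j ∈ Finset.range n, ∑ i ∈ F, σ i * w i * centredIndicator μ (Q ⁻¹' {i}) (ω j)
        ≤ κ * √(2 * V * (n * logTwo n)) := by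
  classical
  have hA : ∀ i, MeasurableSet (Q ⁻¹' {i}) := fun i => hQ (measurableSet_singleton i)
  set f : X → ℝ := fun x => ∑ i ∈ F, σ i * w i * (Q ⁻¹' {i}).indicator (fun _ => (1 : ℝ)) x with hf
  have hfi : Integrable f μ :=
    integrable_finsetSum _ fun i _ => (integrable_indicator_one (hA i)).const_mul _
  have hfval : ∀ x, f x = if Q x ∈ F then σ (Q x) * w (Q x) else 0 := by
    intro x
    have : ∀ i, σ i * w i * (Q ⁻¹' {i}).indicator (fun _ => (1 : ℝ)) x
        = if Q x = i then σ i * w i else 0 := by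
      intro i
      by_cases h : Q x = i
      · simp [Set.indicator, h]
      · simp [Set.indicator, h]
    simp only [hf, this, Finset.sum_ite_eq]
  -- A point lies in only one fibre, so there are no cross terms, and the variance bound depends
  -- neither on `F` nor on the signs.
  have hfsq : ∀ x, f x ^ 2 ≤ w (Q x) ^ 2 := by
    intro x
    rw [hfval]
    split_ifs
    · rw [mul_pow]
      refine mul_le_of_le_one_left (sq_nonneg _) ?_
      rw [← sq_abs]
      exact pow_le_one₀ (abs_nonneg _) (hσ _)
    · simpa using sq_nonneg (w (Q x))
  have hf2 : Integrable (fun x => f x ^ 2) μ :=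
    hint.mono (hfi.aestronglyMeasurable.pow 2) (ae_of_all _ fun x => by
      rw [Real.norm_eq_abs, Real.norm_eq_abs, abs_of_nonneg (sq_nonneg _),
        abs_of_nonneg (sq_nonneg _)]
      exact hfsq x)
  set g : X → ℝ := fun x => ∑ i ∈ F, σ i * w i * centredIndicator μ (Q ⁻¹' {i}) x with hg
  have hci : ∀ i, Integrable (centredIndicator μ (Q ⁻¹' {i})) μ := fun i =>
    (integrable_indicator_one (hA i)).sub (integrable_const _)
  have hg0 : ∫ x, g x ∂μ = 0 := by
    rw [hg, integral_finsetSum _ fun i _ => (hci i).const_mul _]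
    refine Finset.sum_eq_zero fun i _ => ?_
    rw [integral_const_mul, integral_centredIndicator (hA i), mul_zero]
  have hgf : ∀ x, g x = f x - ∑ i ∈ F, σ i * w i * μ.real (Q ⁻¹' {i}) := by
    intro x
    simp only [hg, hf, centredIndicator, mul_sub, Finset.sum_sub_distrib]
  have hfc : ∫ x, f x ∂μ = ∑ i ∈ F, σ i * w i * μ.real (Q ⁻¹' {i}) := by
    have h1 : ∫ x, g x ∂μ = ∫ x, f x ∂μ - ∑ i ∈ F, σ i * w i * μ.real (Q ⁻¹' {i}) := by
      simp_rw [hgf]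
      rw [integral_sub hfi (integrable_const _)]; simp
    linarith
  have hgv : ∫ x, g x ^ 2 ∂μ ≤ V := by
    simp_rw [hgf, ← hfc]
    exact (integral_sub_const_sq_le hfi hf2).trans ((integral_mono hf2 hint hfsq).trans hV)
  have hgm : Measurable g := Finset.measurable_sum _ fun i _ =>
    (measurable_centredIndicator (hA i)).const_mul _
  have hgb : ∀ x, |g x| ≤ ∑ i ∈ F, |w i| := by
    intro x
    refine (Finset.abs_sum_le_sum_abs _ _).trans (Finset.sum_le_sum fun i _ => ?_)
    rw [abs_mul, abs_mul]
    calc |σ i| * |w i| * |centredIndicator μ (Q ⁻¹' {i}) x| ≤ 1 * |w i| * 1 := by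
          gcongr
          · exact hσ i
          · exact abs_centredIndicator_le x
      _ = |w i| := by ring
  exact ae_eventually_sum_le hgm hgb hg0 hgv hV0 hκ

/-- The law of the iterated logarithm for finite weighted sums of absolute deviations. -/
theorem ae_eventually_sum_deviation_le (hQ : Measurable Q) (hw : ∀ i, 0 ≤ w i) (hV0 : 0 < V)
    (hint : Integrable (fun x => w (Q x) ^ 2) μ) (hV : ∫ x, w (Q x) ^ 2 ∂μ ≤ V) (hκ : 1 < κ)
    (F : Finset ι) :
    ∀ᵐ ω ∂(iidLaw μ), ∀ᶠ n : ℕ in atTop,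
      ∑ i ∈ F, ENNReal.ofReal (w i) * deviation μ (Q ⁻¹' {i}) n ω ≤ ENNReal.ofReal (κ * √(2 * V)) := by
  classical
  -- A sign pattern is encoded by the set `J` of its plus signs; finite subsets are countably many,
  -- so one null set serves them all.
  have hall : ∀ᵐ ω ∂(iidLaw μ), ∀ J : Finset ι, ∀ᶠ n : ℕ in atTop,
      ∑ j ∈ Finset.range n, ∑ i ∈ F, (if i ∈ J then (1 : ℝ) else -1) * w i *
        centredIndicator μ (Q ⁻¹' {i}) (ω j) ≤ κ * √(2 * V * (n * logTwo n)) :=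
    ae_all_iff.2 fun J => ae_eventually_signed_sum_le hQ hV0 hint hV hκ F _ fun i => by
      split_ifs <;> simp
  filter_upwards [hall] with ω hω
  have hfin : ∀ᶠ n : ℕ in atTop, ∀ J ∈ F.powerset,
      ∑ j ∈ Finset.range n, ∑ i ∈ F, (if i ∈ J then (1 : ℝ) else -1) * w i *
        centredIndicator μ (Q ⁻¹' {i}) (ω j) ≤ κ * √(2 * V * (n * logTwo n)) :=
    (Filter.eventually_all_finset _).2 fun J _ => hω J
  filter_upwards [hfin, eventually_ge_atTop 1] with n hn hn1
  have hn0 : (0 : ℝ) < n := by exact_mod_cast hn1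
  have hL := logTwo_pos n
  set c : ι → ℝ := fun i => ∑ j ∈ Finset.range n, centredIndicator μ (Q ⁻¹' {i}) (ω j) with hc
  -- Plus signs exactly where the centred sum is nonnegative turn the signed sum into the sum of
  -- absolute values.
  have h1 := hn (F.filter fun i => 0 ≤ c i) (Finset.mem_powerset.2 (Finset.filter_subset _ _))
  rw [Finset.sum_comm] at h1
  have h2 : ∑ i ∈ F, w i * |c i| ≤ κ * √(2 * V * (n * logTwo n)) := by
    refine le_trans (le_of_eq ?_) h1
    refine Finset.sum_congr rfl fun i hi => ?_
    rw [← Finset.mul_sum]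
    change _ = _ * c i
    by_cases h : 0 ≤ c i
    · rw [if_pos (Finset.mem_filter.2 ⟨hi, h⟩), abs_of_nonneg h, one_mul]
    · rw [if_neg (show i ∉ F.filter fun i => 0 ≤ c i from fun h' => h (Finset.mem_filter.1 h').2),
        abs_of_neg (not_le.1 h)]
      ring
  have hD : 0 < √(n * logTwo n) := by positivity
  calc ∑ i ∈ F, ENNReal.ofReal (w i) * deviation μ (Q ⁻¹' {i}) n ω
      = ∑ i ∈ F, ENNReal.ofReal (w i * |c i| / √(n * logTwo n)) := by
        refine Finset.sum_congr rfl fun i _ => ?_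
        rw [deviation_eq (hQ (measurableSet_singleton i)) hn1, ← ENNReal.ofReal_mul (hw i),
          mul_div_assoc]
    _ = ENNReal.ofReal ((∑ i ∈ F, w i * |c i|) / √(n * logTwo n)) := by
        rw [Finset.sum_div, ENNReal.ofReal_sum_of_nonneg]
        intro i _
        have := hw i
        positivity
    _ ≤ _ := by
        refine ENNReal.ofReal_le_ofReal ?_
        rw [div_le_iff₀ hD, mul_assoc, ← Real.sqrt_mul (by positivity)]
        exact h2

end SignedSums

/-! ### Summation over cells, shells and levels -/

section LevelSums

variable {d : ℕ} {p s β : ℝ} {μ : Measure (EuclideanSpace ℝ (Fin d))}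

/-- The weighted sum over the shells of the powers of their masses. -/
noncomputable def shellSum (p s : ℝ) (μ : Measure (EuclideanSpace ℝ (Fin d))) : ℝ≥0∞ :=
  ∑' k : ℕ, ENNReal.ofReal (((2 : ℝ) ^ k) ^ p) * μ (shell ⁻¹' {k}) ^ s

/-- The weight splits into a factor of the level and a factor of the shell, so concavity can be
applied shell by shell. -/
lemma tsum_levelWeight_rpow_le (hs0 : 0 < s) (hs1 : s ≤ 1) (l l' : ℕ) :
    ∑' i, levelWeight p l i * μ (cell l' ⁻¹' {i}) ^ s ≤
      ENNReal.ofReal (((2 : ℝ) ^ l) ^ (-p) * ((32 * 2 ^ l' : ℝ) ^ d) ^ (1 - s)) *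
        shellSum p s μ := by
  simp_rw [levelWeight_eq l, mul_assoc]
  rw [ENNReal.tsum_mul_left, ENNReal.ofReal_mul (by positivity), mul_assoc]
  refine mul_le_mul_right ?_ _
  rw [shellSum, ← ENNReal.tsum_mul_left, ENNReal.tsum_prod']
  refine ENNReal.tsum_le_tsum fun k => ?_
  simp only [levelWeight, pow_zero, div_one]
  rw [ENNReal.tsum_mul_left, mul_left_comm]
  exact mul_le_mul_right (tsum_cell_rpow_le μ hs0 hs1 l' k) _

variable [IsProbabilityMeasure μ]

/-- The level of the weight and that of the partition are independent here: the unmatched remainder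
needs the pair `(0, l)`, the matching cost the pairs `(t, t + 1)`. -/
lemma lintegral_tsum_levelWeight_le (hs0 : 0 < s) (hs : s < 1 / 2) (l l' : ℕ) :
    ∫⁻ ω, ∑' i, levelWeight p l i * supDeviation μ (cell l' ⁻¹' {i}) ω ∂(iidLaw μ) ≤
      ENNReal.ofReal (supConst s) *
        (ENNReal.ofReal (((2 : ℝ) ^ l) ^ (-p) * ((32 * 2 ^ l' : ℝ) ^ d) ^ (1 - s)) *
          shellSum p s μ) := by
  have hA : ∀ i, MeasurableSet (cell (d := d) l' ⁻¹' {i}) := fun i =>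
    measurable_cell l' (measurableSet_singleton i)
  rw [lintegral_tsum fun i => ((measurable_supDeviation (hA i)).const_mul _).aemeasurable]
  calc ∑' i, ∫⁻ ω, levelWeight p l i * supDeviation μ (cell l' ⁻¹' {i}) ω ∂(iidLaw μ)
      ≤ ∑' i, ENNReal.ofReal (supConst s) *
          (levelWeight p l i * μ (cell l' ⁻¹' {i}) ^ s) := by
        refine ENNReal.tsum_le_tsum fun i => ?_
        rw [lintegral_const_mul _ (measurable_supDeviation (hA i)), mul_left_comm]
        exact mul_le_mul_right (lintegral_supDeviation_le (hA i) hs0 hs) _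
    _ ≤ _ := by
        rw [ENNReal.tsum_mul_left]
        exact mul_le_mul_right (tsum_levelWeight_rpow_le hs0 (by linarith) l l') _

/-- The total contribution of the levels after the first one. -/
lemma lintegral_tsum_tsum_levelWeight_le (hs0 : 0 < s) (hs : s < 1 / 2)
    (hlam : 0 < p - d * (1 - s)) :
    ∫⁻ ω, ∑' t : ℕ, ∑' i, levelWeight p t i * supDeviation μ (cell (t + 1) ⁻¹' {i}) ω
        ∂(iidLaw μ) ≤
      ENNReal.ofReal (supConst s) * (ENNReal.ofReal
        (64 ^ (d * (1 - s)) / (1 - 2 ^ (-(p - d * (1 - s))))) * shellSum p s μ) := by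
  have hA : ∀ l i, MeasurableSet (cell (d := d) l ⁻¹' {i}) := fun l i =>
    measurable_cell l (measurableSet_singleton i)
  set u : ℝ := 2 ^ (-(p - d * (1 - s))) with hu
  have hu0 : 0 < u := by positivity
  have hu1 : u < 1 := Real.rpow_lt_one_of_one_lt_of_neg one_lt_two (by linarith)
  -- Successive levels have ratio `2^(-λ)` with `λ = p - d (1 - s)`; the base is `64 = 2 * 32`
  -- because the cells have level `t + 1`.
  have hcoef : ∀ t : ℕ, ((2 : ℝ) ^ t) ^ (-p) * ((32 * 2 ^ (t + 1) : ℝ) ^ d) ^ (1 - s)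
      = 64 ^ (d * (1 - s)) * u ^ t := by
    intro t
    rw [show (32 * 2 ^ (t + 1) : ℝ) = 64 * 2 ^ t by rw [pow_succ]; ring, mul_pow,
      Real.mul_rpow (by positivity) (by positivity), hu, ← Real.rpow_natCast, ← Real.rpow_natCast,
      ← Real.rpow_natCast, ← Real.rpow_natCast, ← Real.rpow_mul (by norm_num),
      ← Real.rpow_mul (by norm_num), ← Real.rpow_mul (by norm_num), ← Real.rpow_mul (by norm_num),
      ← Real.rpow_mul (by norm_num), mul_left_comm, ← Real.rpow_add (by norm_num)]
    congr 2
    ring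
  rw [lintegral_tsum fun t => (Measurable.tsum fun i =>
    (measurable_supDeviation (hA (t + 1) i)).const_mul _).aemeasurable]
  refine (ENNReal.tsum_le_tsum fun t => lintegral_tsum_levelWeight_le hs0 hs t (t + 1)).trans
    (le_of_eq ?_)
  rw [ENNReal.tsum_mul_left, ENNReal.tsum_mul_right]
  congr 2
  simp_rw [hcoef]
  rw [← ENNReal.ofReal_tsum_of_nonneg (fun t => by positivity)
    ((summable_geometric_of_lt_one hu0.le hu1).mul_left _), tsum_mul_left,
    tsum_geometric_of_lt_one hu0.le hu1, div_eq_mul_inv]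

lemma measurable_two_pow_shell_rpow (q : ℝ) :
    Measurable fun x : EuclideanSpace ℝ (Fin d) => ((2 : ℝ) ^ shell x) ^ q :=
  (measurable_from_nat (f := fun k : ℕ => ((2 : ℝ) ^ k) ^ q)).comp measurable_shell

/-- Outside the unit ball `2 ^ shell x < 2 * ‖x‖`, and the exponent may be raised because `‖x‖ ≥ 1`;
the `1` covers the ball. -/
lemma two_pow_shell_rpow_le (hp : 0 ≤ p) (hβ : p ≤ β) (x : EuclideanSpace ℝ (Fin d)) :
    ((2 : ℝ) ^ shell x) ^ p ≤ 1 + 2 ^ p * ‖x‖ ^ β := by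
  rcases h : shell x with _ | k
  · simp only [pow_zero, Real.one_rpow]
    have : 0 ≤ (2 : ℝ) ^ p * ‖x‖ ^ β := by positivity
    linarith
  · have h1 := two_pow_lt_norm_of_shell h
    have h2 : 1 ≤ ‖x‖ := (one_le_pow₀ one_le_two).trans h1.le
    calc ((2 : ℝ) ^ (k + 1)) ^ p ≤ (2 * ‖x‖) ^ p := by
          refine Real.rpow_le_rpow (by positivity) ?_ hp
          rw [pow_succ]; linarith
      _ = 2 ^ p * ‖x‖ ^ p := Real.mul_rpow (by norm_num) (norm_nonneg _)
      _ ≤ 2 ^ p * ‖x‖ ^ β := by gcongr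
      _ ≤ _ := by linarith

lemma integrable_two_pow_shell_rpow (hp : 0 ≤ p) (hβ : p ≤ β)
    (hμ : Integrable (fun x => ‖x‖ ^ β) μ) :
    Integrable (fun x => ((2 : ℝ) ^ shell x) ^ p) μ := by
  refine Integrable.mono' ((integrable_const 1).add (hμ.const_mul (2 ^ p)))
    (measurable_two_pow_shell_rpow p).aestronglyMeasurable (ae_of_all _ fun x => ?_)
  rw [Real.norm_of_nonneg (by positivity)]
  exact two_pow_shell_rpow_le hp hβ x

lemma integral_two_pow_shell_rpow_le (hp : 0 ≤ p) (hβ : p ≤ β)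
    (hμ : Integrable (fun x => ‖x‖ ^ β) μ) :
    ∫ x, ((2 : ℝ) ^ shell x) ^ p ∂μ ≤ 1 + 2 ^ p * absMoment β μ := by
  refine (integral_mono (integrable_two_pow_shell_rpow hp hβ hμ)
    ((integrable_const 1).add (hμ.const_mul (2 ^ p)))
    (two_pow_shell_rpow_le hp hβ)).trans (le_of_eq ?_)
  simp only [Pi.add_apply]
  rw [integral_add (integrable_const _) (hμ.const_mul _), integral_const_mul]
  simp [absMoment]

lemma lintegral_levelWeight_ne_top (hp : 0 ≤ p) (hβ : p ≤ β)
    (hμ : Integrable (fun x => ‖x‖ ^ β) μ) :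
    ∫⁻ x, levelWeight p 0 (cell 0 x) ∂μ ≠ ∞ := by
  have h := (integrable_two_pow_shell_rpow hp hβ hμ).lintegral_lt_top.ne
  simpa [levelWeight, cell] using h

lemma lintegral_enorm_rpow_ne_top (hp : 0 ≤ p) (hβ : p ≤ β)
    (hμ : Integrable (fun x => ‖x‖ ^ β) μ) : ∫⁻ x, ‖x‖ₑ ^ p ∂μ ≠ ∞ :=
  ne_top_of_le_ne_top (lintegral_levelWeight_ne_top hp hβ hμ)
    (lintegral_mono fun x => enorm_rpow_le_levelWeight hp 0 x)

/-- The scaled distance is controlled by the normalized deviations of the cells. -/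
lemma scaledDist_rpow_le (hp : 1 ≤ p) (hμ : ∫⁻ x, levelWeight p 0 (cell 0 x) ∂μ ≠ ∞) (l : ℕ)
    {n : ℕ} (hn : 1 ≤ n) (ω : ℕ → EuclideanSpace ℝ (Fin d)) :
    scaledDist p μ n ω ^ p ≤
      2 ^ (p - 1) * ∑' i, levelWeight p 0 i * deviation μ (cell l ⁻¹' {i}) n ω +
        ∑' t : ℕ, ∑' i, levelWeight p (l + t) i * deviation μ (cell (l + t + 1) ⁻¹' {i}) n ω := by
  have hp0 : 0 < p := by linarith
  have := isProbabilityMeasure_empiricalMeasure hn ω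
  have hL := logTwo_pos n
  have hrate : ENNReal.ofReal (rate p n) ^ p = ENNReal.ofReal √(n / logTwo n) := by
    have h0 : 0 ≤ rate p n := by unfold rate; positivity
    rw [ENNReal.ofReal_rpow_of_nonneg h0 hp0.le, rate, ← Real.rpow_mul (by positivity),
      Real.sqrt_eq_rpow]
    congr 2
    field_simp
  rw [scaledDist, ENNReal.mul_rpow_of_nonneg _ _ hp0.le, hrate]
  refine (mul_le_mul_right (wassersteinDist_rpow_le hp μ (empiricalMeasure n ω) hμ l) _).trans
    (le_of_eq ?_)
  rw [mul_add, mul_left_comm, ← ENNReal.tsum_mul_left, ← ENNReal.tsum_mul_left]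
  simp_rw [← ENNReal.tsum_mul_left, deviation, mul_left_comm (ENNReal.ofReal √(n / logTwo n))]

end LevelSums

/-! ### Constants and the two final bounds -/

section Constants

open Topology

variable {d : ℕ} {p δ s r : ℝ} {μ : Measure (EuclideanSpace ℝ (Fin d))}

/-- This is `(2^p - 1)^2 ≤ 2^p (2^p + 1)`; the final estimates need no more of `K` than this. -/
lemma le_constK (hp : 1 ≤ p) : (2 : ℝ) ^ p * (d : ℝ) ^ (p / 2) ≤ constK d p := by
  have h1 : (2 : ℝ) ≤ 2 ^ p := by
    simpa using Real.rpow_le_rpow_of_exponent_le one_le_two hp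
  unfold constK
  rw [le_div_iff₀ (by nlinarith), show (2 : ℝ) * p = p + p by ring, Real.rpow_add (by norm_num)]
  have h2 : ((2 : ℝ) ^ p - 1) ^ 2 ≤ 2 ^ p * (2 ^ p + 1) := by nlinarith
  have h3 : 0 ≤ (2 : ℝ) ^ p * (d : ℝ) ^ (p / 2) := by positivity
  calc (2 : ℝ) ^ p * (d : ℝ) ^ (p / 2) * ((2 : ℝ) ^ p - 1) ^ 2
      ≤ 2 ^ p * (d : ℝ) ^ (p / 2) * (2 ^ p * (2 ^ p + 1)) := by gcongr
    _ = _ := by ring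

lemma one_le_inv_one_sub_two_rpow {x : ℝ} (hx : 0 < x) :
    0 < 1 - (2 : ℝ) ^ (-x) ∧ 1 ≤ 1 / (1 - (2 : ℝ) ^ (-x)) := by
  have h1 : (2 : ℝ) ^ (-x) < 1 := Real.rpow_lt_one_of_one_lt_of_neg one_lt_two (by linarith)
  have h2 : 0 < (2 : ℝ) ^ (-x) := by positivity
  exact ⟨by linarith, (one_le_div (by linarith)).2 (by linarith)⟩

/-- The exponential growth of the number of cells is absorbed by the power of the dimension. -/
lemma covering_constant_le (hd : 1 ≤ d) (hp : 0 ≤ p) {t : ℝ} (ht0 : t ≤ d) (ht : t ≤ p) :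
    (64 : ℝ) ^ t ≤ (64 : ℝ) ^ (4096 : ℝ) * (d : ℝ) ^ (p / 2) := by
  have hd1 : (1 : ℝ) ≤ d := by exact_mod_cast hd
  -- The threshold is `4096 = 64^2`: beyond it `64 ≤ √d`, so `64^p ≤ d^(p/2)`; below it the exponent
  -- `t ≤ d` is bounded.
  rcases le_total (d : ℝ) 4096 with h | h
  · calc (64 : ℝ) ^ t ≤ 64 ^ (4096 : ℝ) :=
          Real.rpow_le_rpow_of_exponent_le (by norm_num) (by linarith)
      _ ≤ _ := le_mul_of_one_le_right (by positivity) (Real.one_le_rpow hd1 (by linarith))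
  · calc (64 : ℝ) ^ t ≤ 64 ^ p := Real.rpow_le_rpow_of_exponent_le (by norm_num) ht
      _ = 4096 ^ (p / 2) := by
          rw [show (4096 : ℝ) = 64 ^ (2 : ℝ) by norm_num, ← Real.rpow_mul (by norm_num)]
          congr 1; ring
      _ ≤ (d : ℝ) ^ (p / 2) := Real.rpow_le_rpow (by norm_num) h (by linarith)
      _ ≤ _ := le_mul_of_one_le_left (by positivity) (Real.one_le_rpow (by norm_num) (by norm_num))

/-- The assumptions `p > d / 2` and `δ > 0` each push one term of the maximum strictly below `3 /
2`. -/
lemma two_lt_three_div_constM (hd : 1 ≤ d) (hp : 1 ≤ p) (hdp : (d : ℝ) / 2 < p) (hδ : 0 < δ) :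
    2 < 3 / constM d p δ := by
  have hd0 : (0 : ℝ) < d := by exact_mod_cast hd
  have hp0 : 0 < p := by linarith
  have hM1 : 0 < constM d p δ := lt_max_of_lt_right (by positivity)
  rw [lt_div_iff₀ hM1]
  have h1 : 1 / 2 < p / d := by rw [div_lt_div_iff₀ two_pos hd0]; linarith
  have h2 : 1 / (2 + δ / p) < 1 / 2 := by
    gcongr
    linarith [div_pos hδ hp0]
  have h3 : constM d p δ < 3 / 2 := max_lt (by linarith) (by linarith)
  linarith

/-- `r > 2` gives `s = 3 / r - 1 < 1/2`, and `3 / r > M` gives one positive exponent for each term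
of the maximum. -/
lemma exponents_pos (hd : 1 ≤ d) (hp : 1 ≤ p) (hδ : 0 < δ) (hr2 : 2 < r)
    (hr : r < 3 / constM d p δ) :
    0 < 3 / r - 1 ∧ 3 / r - 1 < 1 / 2 ∧ 0 < expLambda d p r ∧ 0 < expSigma p δ r := by
  have hd0 : (0 : ℝ) < d := by exact_mod_cast hd
  have hp0 : 0 < p := by linarith
  have hM1 : 0 < constM d p δ := lt_max_of_lt_right (by positivity)
  have hr0 : 0 < r := by linarith
  have hM : constM d p δ < 3 / r := by
    rw [lt_div_iff₀ hM1] at hr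
    rw [lt_div_iff₀ hr0]; linarith
  have h1 : 2 - p / d < 3 / r := (le_max_left _ _).trans_lt hM
  have h2 : 1 + 1 / (2 + δ / p) < 3 / r := (le_max_right _ _).trans_lt hM
  have h3 : 0 < 1 / (2 + δ / p) := by positivity
  have h4 : 3 / r < 3 / 2 := by gcongr
  refine ⟨by linarith, by linarith, ?_, ?_⟩
  · unfold expLambda
    have h5 : d * (2 - 3 / r) < d * (p / d) := by gcongr; linarith
    rw [mul_div_cancel₀ _ hd0.ne'] at h5
    linarith
  · unfold expSigma
    have h6 : (2 * p + δ) * (1 / (2 + δ / p)) = p := by field_simp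
    have h7 : (2 * p + δ) * (1 / (2 + δ / p)) < (2 * p + δ) * (3 / r - 1) := by gcongr; linarith
    linarith

variable [IsProbabilityMeasure μ]

lemma two_rpow_eq_ofReal (x : ℝ) : (2 : ℝ≥0∞) ^ x = ENNReal.ofReal (2 ^ x) := by
  rw [← ENNReal.ofReal_rpow_of_pos two_pos, ENNReal.ofReal_ofNat]

lemma shellSum_le (hp : 1 ≤ p) (hδ : 0 < δ) (hμ : Integrable (fun x => ‖x‖ ^ (2 * p + δ)) μ)
    (hs0 : 0 < s) (hσ : 0 < (2 * p + δ) * s - p) :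
    shellSum p s μ ≤ ENNReal.ofReal
      (1 + 2 ^ p / (1 - 2 ^ (-((2 * p + δ) * s - p))) * absMoment (2 * p + δ) μ ^ s) :=
  tsum_shell_rpow_le μ (by linarith) hμ hs0 hσ

/-- The uniform moment bound for the scaled distances. -/
theorem lintegral_iSup_scaledDist_le (hd : 1 ≤ d) (hp : 1 ≤ p) (hδ : 0 < δ)
    (hμ : Integrable (fun x => ‖x‖ ^ (2 * p + δ)) μ) (hr2 : 2 < r)
    (hr : r < 3 / constM d p δ) :
    ∫⁻ ω, (⨆ n : ℕ, ⨆ _ : 1 ≤ n, scaledDist p μ n ω) ^ p ∂(iidLaw μ) ≤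
      ENNReal.ofReal (constC p δ r ((64 : ℝ) ^ (4096 : ℝ) * supConst (3 / r - 1)) μ) := by
  have hp0 : 0 < p := by linarith
  obtain ⟨hs0, hs, hlam', hσ'⟩ := exponents_pos hd hp hδ hr2 hr
  set s := 3 / r - 1 with hsdef
  have hlam : 0 < p - d * (1 - s) := by
    rw [expLambda] at hlam'
    rw [hsdef]; linarith
  have hlameq : expLambda d p r = p - d * (1 - s) := by rw [expLambda, hsdef]; ring
  have hσ : 0 < (2 * p + δ) * s - p := hσ'
  have hlw := lintegral_levelWeight_ne_top hp0.le (by linarith : p ≤ 2 * p + δ) hμ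
  set R : (ℕ → EuclideanSpace ℝ (Fin d)) → ℝ≥0∞ := fun ω =>
    ∑' i, levelWeight p 0 i * supDeviation μ (cell 0 ⁻¹' {i}) ω with hR
  set T : (ℕ → EuclideanSpace ℝ (Fin d)) → ℝ≥0∞ := fun ω =>
    ∑' t : ℕ, ∑' i, levelWeight p t i * supDeviation μ (cell (t + 1) ⁻¹' {i}) ω with hT
  have hA : ∀ l i, MeasurableSet (cell (d := d) l ⁻¹' {i}) := fun l i =>
    measurable_cell l (measurableSet_singleton i)
  have hRm : Measurable R := Measurable.tsum fun i =>
    (measurable_supDeviation (hA 0 i)).const_mul _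
  have hpt : ∀ ω, (⨆ n : ℕ, ⨆ _ : 1 ≤ n, scaledDist p μ n ω) ^ p ≤ 2 ^ (p - 1) * R ω + T ω := by
    intro ω
    rw [← ENNReal.le_rpow_inv_iff hp0]
    refine iSup₂_le fun n hn => ?_
    rw [ENNReal.le_rpow_inv_iff hp0]
    refine (scaledDist_rpow_le hp hlw 0 hn ω).trans ?_
    simp only [zero_add, hR, hT]
    gcongr <;> exact deviation_le_supDeviation hn ω
  set a₀ : ℝ := ((32 : ℝ) ^ d) ^ (1 - s) with ha₀
  set a₁ : ℝ := 64 ^ (d * (1 - s)) / (1 - 2 ^ (-(p - d * (1 - s)))) with ha₁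
  set m : ℝ := 1 + 2 ^ p / (1 - 2 ^ (-((2 * p + δ) * s - p))) * absMoment (2 * p + δ) μ ^ s with hm
  obtain ⟨hl0, hl1⟩ := one_le_inv_one_sub_two_rpow hlam
  obtain ⟨hσ0, -⟩ := one_le_inv_one_sub_two_rpow hσ
  have hm0 : 0 ≤ m := by
    have := absMoment_nonneg (2 * p + δ) μ
    positivity
  have hC := supConst_pos s
  have ha₁0 : 0 ≤ a₁ := by positivity
  have h1 := lintegral_tsum_levelWeight_le (p := p) (μ := μ) hs0 hs 0 0
  simp only [pow_zero, Real.one_rpow, mul_one, one_mul] at h1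
  have h2 := lintegral_tsum_tsum_levelWeight_le (p := p) (μ := μ) hs0 hs hlam
  have h3 := shellSum_le hp hδ hμ hs0 hσ
  have ha₀le : a₀ ≤ 64 ^ (d * (1 - s)) := by
    rw [ha₀, ← Real.rpow_natCast, ← Real.rpow_mul (by norm_num)]
    exact Real.rpow_le_rpow (by norm_num) (by norm_num)
      (mul_nonneg (Nat.cast_nonneg d) (by linarith))
  -- The exponent `d (1 - s)` is at most `p` because `λ > 0`.
  have hcov : (64 : ℝ) ^ (d * (1 - s)) ≤ (64 : ℝ) ^ (4096 : ℝ) * (d : ℝ) ^ (p / 2) := by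
    refine covering_constant_le hd hp0.le ?_ (by linarith)
    have : (0 : ℝ) ≤ d := Nat.cast_nonneg d
    nlinarith
  calc ∫⁻ ω, (⨆ n : ℕ, ⨆ _ : 1 ≤ n, scaledDist p μ n ω) ^ p ∂(iidLaw μ)
      ≤ ∫⁻ ω, (2 ^ (p - 1) * R ω + T ω) ∂(iidLaw μ) := lintegral_mono hpt
    _ = 2 ^ (p - 1) * ∫⁻ ω, R ω ∂(iidLaw μ) + ∫⁻ ω, T ω ∂(iidLaw μ) := by
        rw [lintegral_add_left (hRm.const_mul _), lintegral_const_mul _ hRm]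
    _ ≤ ENNReal.ofReal (2 ^ (p - 1)) *
          (ENNReal.ofReal (supConst s) * (ENNReal.ofReal a₀ * ENNReal.ofReal m)) +
          ENNReal.ofReal (supConst s) * (ENNReal.ofReal a₁ * ENNReal.ofReal m) := by
        rw [two_rpow_eq_ofReal]
        refine add_le_add (mul_le_mul_right (h1.trans ?_) _) (h2.trans ?_) <;> gcongr
    _ = ENNReal.ofReal (supConst s * (2 ^ (p - 1) * a₀ + a₁) * m) := by
        rw [← ENNReal.ofReal_mul (by positivity), ← ENNReal.ofReal_mul (by positivity),
          ← ENNReal.ofReal_mul (by positivity), ← ENNReal.ofReal_mul (by positivity),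
          ← ENNReal.ofReal_mul (by positivity), ← ENNReal.ofReal_add (by positivity)
          (by positivity)]
        congr 1; ring
    _ ≤ _ := by
        refine ENNReal.ofReal_le_ofReal ?_
        have hconst : constC p δ r ((64 : ℝ) ^ (4096 : ℝ) * supConst s) μ =
            constK d p * ((64 : ℝ) ^ (4096 : ℝ) * supConst s) / (1 - 2 ^ (-(p - d * (1 - s)))) * m := by
          rw [constC, hlameq]; rfl
        rw [hconst]
        refine mul_le_mul_of_nonneg_right ?_ hm0
        set q : ℝ := 1 / (1 - 2 ^ (-(p - d * (1 - s)))) with hq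
        have hp1 : (1 : ℝ) ≤ 2 ^ (p - 1) := Real.one_le_rpow one_le_two (by linarith)
        have hp2 : (2 : ℝ) ^ p = 2 * 2 ^ (p - 1) := by
          rw [Real.rpow_sub_one (by norm_num)]; ring
        have hD : (0 : ℝ) ≤ 64 ^ (d * (1 - s)) := by positivity
        -- The remainder at level `0` and the sum over levels each cost at most `2^(p-1) *
        -- 64^(d(1-s)) * q`.
        have h5 : 2 ^ (p - 1) * a₀ + a₁ ≤ 2 ^ p * 64 ^ (d * (1 - s)) * q := by
          have e1 : a₁ = 64 ^ (d * (1 - s)) * q := by rw [ha₁, hq]; ring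
          have e2 : 2 ^ (p - 1) * a₀ ≤ 2 ^ (p - 1) * (64 ^ (d * (1 - s)) * q) := by
            gcongr
            exact ha₀le.trans (le_mul_of_one_le_right hD hl1)
          have e3 : 64 ^ (d * (1 - s)) * q ≤ 2 ^ (p - 1) * (64 ^ (d * (1 - s)) * q) :=
            le_mul_of_one_le_left (by positivity) hp1
          rw [e1, hp2]
          linarith
        calc supConst s * (2 ^ (p - 1) * a₀ + a₁)
            ≤ supConst s * (2 ^ p * 64 ^ (d * (1 - s)) * q) := by gcongr
          _ ≤ supConst s * (2 ^ p * ((64 : ℝ) ^ (4096 : ℝ) * (d : ℝ) ^ (p / 2)) * q) := by gcongr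
          _ = (2 ^ p * (d : ℝ) ^ (p / 2)) * ((64 : ℝ) ^ (4096 : ℝ) * supConst s) * q := by ring
          _ ≤ constK d p * ((64 : ℝ) ^ (4096 : ℝ) * supConst s) * q := by
              gcongr
              exact le_constK hp
          _ = _ := by rw [hq]; ring

/-- Every factor of `Y_p^p` missing on the left is at least `1`: `K ≥ 2^p`, and both inverse factors
`1 / (1 - 2^(-x))` exceed `1`. -/
lemma scaled_bound_le_constY (hd : 1 ≤ d) (hp : 1 ≤ p) (hdp : (d : ℝ) / 2 < p) (hδ : 0 < δ) :
    ENNReal.ofReal (2 ^ p * (√2 * (1 + 2 ^ p * √(absMoment (2 * p + δ) μ)))) ≤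
      ENNReal.ofReal (constY p δ μ) ^ p := by
  have hp0 : 0 < p := by linarith
  have hd1 : (1 : ℝ) ≤ d := by exact_mod_cast hd
  have hm := absMoment_nonneg (2 * p + δ) μ
  obtain ⟨h1, h1'⟩ := one_le_inv_one_sub_two_rpow (show 0 < p - (d : ℝ) / 2 by linarith)
  obtain ⟨h2, h2'⟩ := one_le_inv_one_sub_two_rpow (show 0 < δ / 2 by linarith)
  have hK : (2 : ℝ) ^ p ≤ constK d p :=
    (le_mul_of_one_le_right (by positivity) (Real.one_le_rpow hd1 (by linarith))).trans
      (le_constK hp)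
  have hK0 : 0 ≤ constK d p := le_trans (by positivity) hK
  have hY0 : 0 ≤ constY p δ μ := by unfold constY; positivity
  rw [ENNReal.ofReal_rpow_of_nonneg hY0 hp0.le]
  refine ENNReal.ofReal_le_ofReal ?_
  rw [constY, ← Real.rpow_mul (by positivity), one_div_mul_cancel hp0.ne', Real.rpow_one,
    Real.sqrt_eq_rpow (absMoment _ _)]
  set m := absMoment (2 * p + δ) μ ^ ((1 : ℝ) / 2)
  have hm0 : 0 ≤ m := by positivity
  calc 2 ^ p * (√2 * (1 + 2 ^ p * m))
      ≤ constK d p * (√2 * (1 + 2 ^ p * (1 / (1 - (2 : ℝ) ^ (-(δ / 2)))) * m)) := by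
        gcongr
        exact le_mul_of_one_le_right (by positivity) h2'
    _ ≤ (constK d p * (√2 * (1 + 2 ^ p * (1 / (1 - (2 : ℝ) ^ (-(δ / 2)))) * m))) *
          (1 / (1 - (2 : ℝ) ^ (-(p - (d : ℝ) / 2)))) :=
        le_mul_of_one_le_right (by positivity) h1'
    _ = _ := by ring

/-- The almost sure bound for the scaled distances. -/
theorem ae_limsup_scaledDist_le (hd : 1 ≤ d) (hp : 1 ≤ p) (hdp : (d : ℝ) / 2 < p) (hδ : 0 < δ)
    (hμ : Integrable (fun x => ‖x‖ ^ (2 * p + δ)) μ) :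
    ∀ᵐ ω ∂(iidLaw μ), limsup (fun n : ℕ => scaledDist p μ n ω) atTop ≤
      ENNReal.ofReal (constY p δ μ) := by
  have hp0 : 0 < p := by linarith
  -- Only finiteness of the suprema is drawn from the moment bounds, so any admissible `r` will do.
  obtain ⟨r, hr2, hr⟩ := exists_between (two_lt_three_div_constM hd hp hdp hδ)
  obtain ⟨hs0, hs, hlam', hσ'⟩ := exponents_pos hd hp hδ hr2 hr
  set s := 3 / r - 1 with hsdef
  have hlam : 0 < p - d * (1 - s) := by
    rw [expLambda] at hlam'
    rw [hsdef]; linarith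
  have hσ : 0 < (2 * p + δ) * s - p := hσ'
  have hlw := lintegral_levelWeight_ne_top hp0.le (by linarith : p ≤ 2 * p + δ) hμ
  have hA : ∀ l i, MeasurableSet (cell (d := d) l ⁻¹' {i}) := fun l i =>
    measurable_cell l (measurableSet_singleton i)
  have hshell : shellSum p s μ ≠ ∞ :=
    ne_top_of_le_ne_top ENNReal.ofReal_ne_top (shellSum_le hp hδ hμ hs0 hσ)
  have hRfin : ∀ᵐ ω ∂(iidLaw μ), ∀ l : ℕ,
      ∑' i, levelWeight p 0 i * supDeviation μ (cell l ⁻¹' {i}) ω < ∞ := by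
    refine ae_all_iff.2 fun l => ae_lt_top (Measurable.tsum fun i =>
      (measurable_supDeviation (hA l i)).const_mul _) ?_
    refine ne_top_of_le_ne_top ?_ (lintegral_tsum_levelWeight_le hs0 hs 0 l)
    exact ENNReal.mul_ne_top ENNReal.ofReal_ne_top (ENNReal.mul_ne_top ENNReal.ofReal_ne_top hshell)
  have hTfin : ∀ᵐ ω ∂(iidLaw μ),
      ∑' t : ℕ, ∑' i, levelWeight p t i * supDeviation μ (cell (t + 1) ⁻¹' {i}) ω < ∞ := by
    refine ae_lt_top (Measurable.tsum fun t => Measurable.tsum fun i =>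
      (measurable_supDeviation (hA (t + 1) i)).const_mul _) ?_
    refine ne_top_of_le_ne_top ?_ (lintegral_tsum_tsum_levelWeight_le hs0 hs hlam)
    exact ENNReal.mul_ne_top ENNReal.ofReal_ne_top (ENNReal.mul_ne_top ENNReal.ofReal_ne_top hshell)
  set m := absMoment (2 * p + δ) μ with hm
  have hm0 : 0 ≤ m := absMoment_nonneg _ _
  -- `V` bounds the second moment of the weight `2^(k p)`, which is where a moment of order at least
  -- `2p` enters.
  set V : ℝ := 1 + 2 ^ (2 * p) * m with hV
  have hV0 : 0 < V := by positivity
  have hsq : ∀ x : EuclideanSpace ℝ (Fin d),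
      (((2 : ℝ) ^ shell x) ^ p) ^ 2 = ((2 : ℝ) ^ shell x) ^ (2 * p) := fun x => by
    rw [← Real.rpow_mul_natCast (by positivity), mul_comm p]; rfl
  have hlil : ∀ᵐ ω ∂(iidLaw μ), ∀ (l : ℕ) (F : Finset (ℕ × (Fin d → ℤ))), ∀ᶠ n : ℕ in atTop,
      ∑ i ∈ F, levelWeight p 0 i * deviation μ (cell l ⁻¹' {i}) n ω ≤
        ENNReal.ofReal (5 / 4 * √(2 * V)) := by
    refine ae_all_iff.2 fun l => ae_all_iff.2 fun F => ?_
    have h := ae_eventually_sum_deviation_le (μ := μ) (measurable_cell (d := d) l)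
      (w := fun i => ((2 : ℝ) ^ i.1) ^ p) (fun i => by positivity) hV0
      (by
        change Integrable (fun x => (((2 : ℝ) ^ shell x) ^ p) ^ 2) μ
        simp_rw [hsq]
        exact integrable_two_pow_shell_rpow (by linarith) (by linarith) hμ)
      (by
        change ∫ x, (((2 : ℝ) ^ shell x) ^ p) ^ 2 ∂μ ≤ V
        simp_rw [hsq]
        exact integral_two_pow_shell_rpow_le (by linarith) (by linarith) hμ)
      (show (1 : ℝ) < 5 / 4 by norm_num) F
    simpa [levelWeight] using h
  set G : ℝ := √2 * (1 + 2 ^ p * √m) with hG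
  have hG0 : 0 < G := by positivity
  have hVG : √(2 * V) ≤ G := by
    rw [Real.sqrt_mul (by norm_num), hG]
    gcongr
    refine Real.sqrt_le_iff.2 ⟨by positivity, ?_⟩
    have e1 : √m ^ 2 = m := Real.sq_sqrt hm0
    have e2 : (2 : ℝ) ^ (2 * p) = 2 ^ p * 2 ^ p := by
      rw [two_mul, Real.rpow_add (by norm_num)]
    have e3 : 0 ≤ 2 * ((2 : ℝ) ^ p * √m) := by positivity
    calc V = 1 + 2 ^ p * 2 ^ p * √m ^ 2 := by rw [hV, e1, e2]
      _ ≤ _ := by linarith [show (1 + (2 : ℝ) ^ p * √m) ^ 2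
          = 1 + 2 ^ p * 2 ^ p * √m ^ 2 + 2 * (2 ^ p * √m) by ring]
  filter_upwards [hRfin, hTfin, hlil] with ω hRω hTω hω
  have hp2 : (2 : ℝ) ^ p = 2 * 2 ^ (p - 1) := by
    rw [Real.rpow_sub_one (by norm_num)]; ring
  -- The budget is `2^p G`: the fine levels get `2^(p-1) G / 2`, the cells outside `F` get `G / 4`
  -- and those in `F` get `5 G / 4`, the last two multiplied by `2^(p-1)`. Tails are taken with the
  -- suprema, so `l` and `F` do not depend on `n`.
  obtain ⟨l, hl⟩ : ∃ l : ℕ, ∑' t : ℕ, ∑' i, levelWeight p (l + t) i *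
      supDeviation μ (cell (l + t + 1) ⁻¹' {i}) ω ≤ ENNReal.ofReal (2 ^ (p - 1) * (G / 2)) := by
    have h := ENNReal.tendsto_sum_nat_add (fun t : ℕ =>
      ∑' i, levelWeight p t i * supDeviation μ (cell (t + 1) ⁻¹' {i}) ω) hTω.ne
    have hpos : (0 : ℝ≥0∞) < ENNReal.ofReal (2 ^ (p - 1) * (G / 2)) := by
      rw [ENNReal.ofReal_pos]; positivity
    obtain ⟨l, hl⟩ := (h.eventually (Iic_mem_nhds hpos)).exists
    refine ⟨l, ?_⟩
    simp_rw [add_comm l]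
    exact hl
  obtain ⟨F, hF⟩ : ∃ F : Finset (ℕ × (Fin d → ℤ)), ∑' i : {i // i ∉ F}, levelWeight p 0 i.1 *
      supDeviation μ (cell l ⁻¹' {i.1}) ω ≤ ENNReal.ofReal (G / 4) := by
    have h := ENNReal.tendsto_tsum_compl_atTop_zero (hRω l).ne
    have hpos : (0 : ℝ≥0∞) < ENNReal.ofReal (G / 4) := by
      rw [ENNReal.ofReal_pos]; positivity
    exact (h.eventually (Iic_mem_nhds hpos)).exists
  refine limsup_le_of_le (by isBoundedDefault) ?_
  filter_upwards [hω l F, eventually_ge_atTop 1] with n hn hn1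
  rw [← ENNReal.rpow_le_rpow_iff hp0]
  refine le_trans ?_ (scaled_bound_le_constY hd hp hdp hδ)
  refine (scaledDist_rpow_le hp hlw l hn1 ω).trans ?_
  have htop : ∑' i, levelWeight p 0 i * deviation μ (cell l ⁻¹' {i}) n ω ≤
      ENNReal.ofReal (3 / 2 * G) := by
    rw [← ENNReal.sum_add_tsum_compl F]
    calc _ ≤ ENNReal.ofReal (5 / 4 * √(2 * V)) + ENNReal.ofReal (G / 4) := by
          refine add_le_add hn (le_trans ?_ hF)
          refine ENNReal.tsum_le_tsum fun i => ?_
          exact mul_le_mul_right (deviation_le_supDeviation hn1 ω) _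
      _ = ENNReal.ofReal (5 / 4 * √(2 * V) + G / 4) := by
          rw [ENNReal.ofReal_add (by positivity) (by positivity)]
      _ ≤ _ := ENNReal.ofReal_le_ofReal (by linarith)
  have htail : ∑' t : ℕ, ∑' i, levelWeight p (l + t) i *
      deviation μ (cell (l + t + 1) ⁻¹' {i}) n ω ≤ ENNReal.ofReal (2 ^ (p - 1) * (G / 2)) := by
    refine le_trans (ENNReal.tsum_le_tsum fun t => ENNReal.tsum_le_tsum fun i => ?_) hl
    exact mul_le_mul_right (deviation_le_supDeviation hn1 ω) _
  calc _ ≤ ENNReal.ofReal (2 ^ (p - 1)) * ENNReal.ofReal (3 / 2 * G) +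
        ENNReal.ofReal (2 ^ (p - 1) * (G / 2)) := by
        rw [two_rpow_eq_ofReal]
        exact add_le_add (mul_le_mul_right htop _) htail
    _ = ENNReal.ofReal (2 ^ p * G) := by
        rw [← ENNReal.ofReal_mul (by positivity), ← ENNReal.ofReal_add (by positivity)
          (by positivity), hp2]
        congr 1; ring
    _ ≤ _ := le_rfl

end Constants

end EmpiricalWasserstein

theorem mainTheorem1 :
    ∃ Cbar : ℝ → ℝ, (∀ r, 0 < Cbar r) ∧
      ∀ (d : ℕ) (p δ : ℝ) (μ : Measure (EuclideanSpace ℝ (Fin d))) [IsProbabilityMeasure μ],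
        1 ≤ d → 1 ≤ p → (d : ℝ) / 2 < p → 0 < δ →
        Integrable (fun x => ‖x‖ ^ (2 * p + δ)) μ →
        -- the distances are random variables
        (∀ n : ℕ, 1 ≤ n → Measurable fun ω : ℕ → EuclideanSpace ℝ (Fin d) =>
          EmpiricalWasserstein.wassersteinDist p μ
            (EmpiricalWasserstein.empiricalMeasure n ω)) ∧
        -- the interval of admissible exponents `r` is nonempty
        2 < 3 / EmpiricalWasserstein.constM d p δ ∧
        -- the uniform moment bound
        (∀ r : ℝ, 2 < r → r < 3 / EmpiricalWasserstein.constM d p δ →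
          0 < EmpiricalWasserstein.expLambda d p r ∧
          0 < EmpiricalWasserstein.expSigma p δ r ∧
          ∫⁻ ω, (⨆ n : ℕ, ⨆ _ : 1 ≤ n, EmpiricalWasserstein.scaledDist p μ n ω) ^ p
              ∂(EmpiricalWasserstein.iidLaw μ) ≤
            ENNReal.ofReal (EmpiricalWasserstein.constC p δ r (Cbar r) μ)) ∧
        -- the almost sure bound
        (∀ᵐ ω ∂(EmpiricalWasserstein.iidLaw μ),
          limsup (fun n : ℕ => EmpiricalWasserstein.scaledDist p μ n ω) atTop ≤
            ENNReal.ofReal (EmpiricalWasserstein.constY p δ μ)) := by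
  -- The first factor is the dimension-free covering constant, the second the uniform constant at `s
  -- = 3 / r - 1`; both are free of `d`, `p`, `δ` and `μ`.
  refine ⟨fun r => (64 : ℝ) ^ (4096 : ℝ) * EmpiricalWasserstein.supConst (3 / r - 1),
    fun r => mul_pos (by positivity) (EmpiricalWasserstein.supConst_pos _), ?_⟩
  intro d p δ μ _ hd hp hdp hδ hμ
  refine ⟨fun n hn => ?_, EmpiricalWasserstein.two_lt_three_div_constM hd hp hdp hδ,
    fun r hr2 hr => ?_, EmpiricalWasserstein.ae_limsup_scaledDist_le hd hp hdp hδ hμ⟩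
  · exact EmpiricalWasserstein.measurable_wassersteinDist_empiricalMeasure hp μ
      (EmpiricalWasserstein.lintegral_enorm_rpow_ne_top (by linarith) (by linarith) hμ) hn
  · obtain ⟨-, -, h1, h2⟩ := EmpiricalWasserstein.exponents_pos hd hp hδ hr2 hr
    exact ⟨h1, h2, EmpiricalWasserstein.lintegral_iSup_scaledDist_le hd hp hδ hμ hr2 hr⟩
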